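/- **Notation.** Let $r\in(0,1)$, $\mathcal C_r=\{|\lambda|=r\}$, $\mathcal D_r=\{|\lambda|<r\}$, $\mathcal A_r=\{r<|\lambda|<1/r\}$, and $X^*(\lambda)=\overline{X(1/\bar\lambda)}^{\,t}$. Let $\Lambda_r$ be the group of analytic maps $\mathcal C_r\to \mathrm{SL}_2(\mathbb C)$. Let $\Lambda^u_r\subset\Lambda_r$ (resp. $\Lambda^{u,\mathrm{mer}}_r\subset\Lambda_r$) be the loops that are boundary values of a holomorphic (resp. meromorphic) map $X:\mathcal A_r\to \mathrm{SL}_2(\mathbb C)$ with $X^*=X^{-1}$ (resp. away from its poles), and $\Lambda^+_r\subset\Lambda_r$ the loops that are boundary values of a holomorphic map $X:\mathcal D_r\to \mathrm{SL}_2(\mathbb C)$ with $X(0)$ upper triangular with positive real diagonal. Loops are identified with these extensions. Write $\Phi=\mathrm{Uni}_r(\Phi)\,\mathrm{Pos}_r(\Phi)$ with $\mathrm{Uni}_r(\Phi)\in\Lambda_r^u$, $\mathrm{Pos}_r(\Phi)\in\Lambda^+_r$ for the $r$-Iwasawa factorization of $\Phi\in\Lambda_r$, and $\mathrm{sing}\,U\subset\mathcal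 A_r$ for the set of poles of $U\in\Lambda^{u,\mathrm{mer}}_r$. Write $\|X\|_{\mathcal R}=\sup_{\lambda\in\mathcal R}|X(\lambda)|$ with $|\cdot|$ the operator norm of the Hermitian norm on $\mathbb C^2$. For $r<|\lambda_0|<1$ and a line $L\in\mathbb{CP}^1$ let $f$ be the degree one rational map with pole $\lambda_0$, $f^*=f^{-1}$ and $f(1)=1$, and put $h=f^{1/2}\pi_L+f^{-1/2}\pi_{L^\perp}$ on $\overline{\mathcal D_r}$ ($\pi$ denoting orthogonal projection). The normalized simple factor is $\psi_{\lambda_0,L}=Q^{-1}h\in\Lambda^+_r$, where $Q\in\mathrm{SU}(2)$ is the unitary factor of the QR-decomposition of $h(0)$. **Theorem (Bridge theorem).** Let $\Sigma^*\subset\mathbb C$ be a punctured neighbourhood of $0$ with universal cover $\widetilde{\Sigma^*}$, and let $\Phi_1,\Phi_2:\widetilde{\Sigma^*}\to\Lambda_r$ be maps (for instance analytic maps; no regularity in $z$ is needed). Let $U\in\Lambda^{u,\mathrm{mer}}_r$ and $V\in\Lambda^+_r$, and suppose that for every region $\mathcal A\subseteq\mathcal A_r$ bounded away from $\mathrm{sing}\,U$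 $$\lim_{z\to0}\bigl\|\mathrm{Uni}_r(\Phi_1)^{-1}\,U\,\mathrm{Uni}_r(\Phi_2)-\mathrm{id}\bigr\|_{\mathcal A}=0,\qquad \lim_{z\to0}\bigl\|\mathrm{Pos}_r(\Phi_2)\,V^{-1}\,\mathrm{Pos}_r(\Phi_1)^{-1}-\mathrm{id}\bigr\|_{\mathcal D_r}=0,$$ where $z\to 0$ means that the image in $\Sigma^*$ of the point of $\widetilde{\Sigma^*}$ tends to $0$. For $k\in\{1,2\}$ let $g_k=W\psi_{\lambda_0,L_k}$, where $W\in\mathrm{SU}(2)$, $r<|\lambda_0|<1$, $\lambda_0\notin\mathrm{sing}\,U$, and $L_1,L_2\in\mathbb{CP}^1$ satisfy $L_2=\overline{U(\lambda_0)}^{\,t}L_1$. Then the loop $g_1Ug_2^{-1}$ on $\mathcal C_r$ belongs to $\Lambda^{u,\mathrm{mer}}_r$, and, for every region $\mathcal A'\subseteq\mathcal A_r$ bounded away from $\mathrm{sing}\,U\cup\{\lambda_0,1/\bar\lambda_0\}$, $$\lim_{z\to0}\bigl\|\mathrm{Uni}_r(g_1\Phi_1)^{-1}\,(g_1Ug_2^{-1})\,\mathrm{Uni}_r(g_2\Phi_2)-\mathrm{id}\bigr\|_{\mathcal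 A'}=0,\qquad \lim_{z\to0}\bigl\|\mathrm{Pos}_r(g_2\Phi_2)\,V^{-1}\,\mathrm{Pos}_r(g_1\Phi_1)^{-1}-\mathrm{id}\bigr\|_{\mathcal D_r}=0.$$ -/

import Mathlib

open Filter Topology Metric
open scoped Matrix Matrix.Norms.L2Operator LinearAlgebra.Projectivization ComplexConjugate

noncomputable section

namespace Bridge

/-- Complex `2 × 2` matrices. The norm in force is the operator norm induced by the Hermitian
norm on `ℂ²`. -/
abbrev Mat2 : Type := Matrix (Fin 2) (Fin 2) ℂ

/-- The open annulus `𝒜_r = {r < |l| < 1/r}`. -/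
def annulus (r : ℝ) : Set ℂ := {l | r < ‖l‖ ∧ ‖l‖ < 1 / r}

/-- The reflection `l ↦ 1 / conj l` in the unit circle. -/
def reflect (l : ℂ) : ℂ := 1 / conj l

/-- Upper triangular matrices of determinant one with positive real diagonal. -/
def PosTriangular (T : Mat2) : Prop :=
  T.det = 1 ∧ T 1 0 = 0 ∧ ∀ i, (T i i).im = 0 ∧ 0 < (T i i).re

/-- The values of `X` on the circle `|l| = r` form an analytic loop in `SL₂(ℂ)`: they have
determinant one and are the restriction of a map that is holomorphic near the circle. The values
of `X` off the circle play no role. -/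
def IsLoop (r : ℝ) (X : ℂ → Mat2) : Prop :=
  (∀ l ∈ sphere (0 : ℂ) r, (X l).det = 1) ∧
    ∃ Y : ℂ → Mat2, AnalyticOnNhd ℂ Y (sphere 0 r) ∧ Set.EqOn X Y (sphere 0 r)

/-- The values of `X` on the circle `|l| = r` are the boundary values of `X` restricted to the
domain `D`. A loop that is the boundary of a map on `D` is recorded, together with
that map, as a single function `X`. -/
def IsBoundaryOf (r : ℝ) (D : Set ℂ) (X : ℂ → Mat2) : Prop :=
  ∀ l ∈ sphere (0 : ℂ) r, Tendsto X (𝓝[D] l) (𝓝 (X l))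

/-- The `r`-unitary loops: boundaries of holomorphic maps `𝒜_r → SL₂(ℂ)` with `X^* = X⁻¹`, where
`X^*(l)` is the conjugate transpose of `X (1 / conj l)`. -/
structure IsUnitaryLoop (r : ℝ) (X : ℂ → Mat2) : Prop where
  loop : IsLoop r X
  holo : DifferentiableOn ℂ X (annulus r)
  boundary : IsBoundaryOf r (annulus r) X
  det_eq : ∀ l ∈ annulus r, (X l).det = 1
  unitary : ∀ l ∈ annulus r, (X (reflect l))ᴴ = (X l)⁻¹

/-- The positive `r`-loops `X`, boundaries of holomorphic maps `{|l| < r} → SL₂(ℂ)`, that are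
normalized by: `X 0` is upper triangular with positive diagonal. -/
structure IsPositiveLoop (r : ℝ) (X : ℂ → Mat2) : Prop where
  loop : IsLoop r X
  holo : DifferentiableOn ℂ X (ball 0 r)
  boundary : IsBoundaryOf r (ball 0 r) X
  det_eq : ∀ l ∈ ball (0 : ℂ) r, (X l).det = 1
  normalized : PosTriangular (X 0)

/-- The set of poles in `𝒜_r`. -/
def sing (r : ℝ) (X : ℂ → Mat2) : Set ℂ := {l ∈ annulus r | meromorphicOrderAt X l < 0}

/-- The meromorphic `r`-unitary loops: analytic loops that are boundaries of meromorphic maps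
`𝒜_r → SL₂(ℂ)` with `X^* = X⁻¹` away from the poles. Normal form means that `X` has no
removable singularities, so that its values off the poles are the right ones. -/
structure IsMeroUnitaryLoop (r : ℝ) (X : ℂ → Mat2) : Prop where
  loop : IsLoop r X
  mero : MeromorphicNFOn X (annulus r)
  boundary : IsBoundaryOf r (annulus r) X
  det_eq : ∀ l ∈ annulus r \ sing r X, (X l).det = 1
  unitary : ∀ l ∈ annulus r \ sing r X, (X (reflect l))ᴴ = (X l)⁻¹

/-- `X = F B` is the `r`-Iwasawa factorization of the loop `X`: `F` is its `r`-unitary factor and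
`B` its `r`-positive factor. -/
structure IsIwasawa (r : ℝ) (X F B : ℂ → Mat2) : Prop where
  unitary : IsUnitaryLoop r F
  positive : IsPositiveLoop r B
  mul_eq : ∀ l ∈ sphere (0 : ℂ) r, X l = F l * B l

/-- A region of `𝒜_r` (open and connected) that is bounded away from the set `S`. -/
structure IsRegionAwayFrom (r : ℝ) (S R : Set ℂ) : Prop where
  isOpen : IsOpen R
  connected : IsConnected R
  subset : R ⊆ annulus r
  away : ∃ δ > 0, ∀ l ∈ R, ∀ s ∈ S, δ ≤ dist l s

/-- The Iwasawa factors `F₁, B₁` of `Φ₁` and `F₂, B₂` of `Φ₂` converge to each other modulo `U`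
and `V` as `z → 0`, where `z : E → ℂ`: one has `F₁⁻¹ U F₂ → 1` uniformly on every region of `𝒜_r`
that is bounded away from `S`, and `B₂ V⁻¹ B₁⁻¹ → 1` uniformly on `{|l| < r}`. -/
def IwasawaConverge {E : Type*} (r : ℝ) (z : E → ℂ) (Φ₁ Φ₂ : E → ℂ → Mat2)
    (U V : ℂ → Mat2) (S : Set ℂ) : Prop :=
  ∀ F₁ B₁ F₂ B₂ : E → ℂ → Mat2,
    (∀ p, IsIwasawa r (Φ₁ p) (F₁ p) (B₁ p)) → (∀ p, IsIwasawa r (Φ₂ p) (F₂ p) (B₂ p)) →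
    (∀ R : Set ℂ, IsRegionAwayFrom r S R →
      TendstoUniformlyOn (fun p l => (F₁ p l)⁻¹ * U l * F₂ p l) (fun _ => 1)
        (comap z (𝓝 0)) R) ∧
    TendstoUniformlyOn (fun p l => B₂ p l * (V l)⁻¹ * (B₁ p l)⁻¹) (fun _ => 1)
      (comap z (𝓝 0)) (ball 0 r)

/-- Complex projective line. -/
abbrev CP1 : Type := ℙ ℂ (EuclideanSpace ℂ (Fin 2))

/-- The matrix of the orthogonal projection of `ℂ²` onto a subspace. -/
def projMatrix (K : Submodule ℂ (EuclideanSpace ℂ (Fin 2))) : Mat2 :=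
  (Matrix.toEuclideanCLM (n := Fin 2) (𝕜 := ℂ)).symm K.starProjection

/-- The rational map `f` of degree one with pole at `l₀`, `f^* = f⁻¹` and `f 1 = 1`
(for `0 < |l₀| < 1`). -/
def ratMap (l₀ l : ℂ) : ℂ := (1 - l₀) / (1 - conj l₀) * ((1 - conj l₀ * l) / (l - l₀))

/-- `h = f^{1/2} π_L + f^{-1/2} π_{L^⊥}` on `{|l| ≤ r}`, for a holomorphic branch `s` of
`f^{1/2}`. -/
def IsUnnormalizedSimpleFactor (r : ℝ) (l₀ : ℂ) (L : CP1) (h : ℂ → Mat2) : Prop :=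
  ∃ s : ℂ → ℂ, AnalyticOnNhd ℂ s (closedBall 0 r) ∧
    (∀ l ∈ closedBall (0 : ℂ) r, s l ^ 2 = ratMap l₀ l) ∧
    ∀ l ∈ closedBall (0 : ℂ) r,
      h l = s l • projMatrix L.submodule + (s l)⁻¹ • projMatrix L.submoduleᗮ

/-- `g = Q⁻¹ h` with `h` an unnormalized simple factor and `Q` the unitary factor of the
QR-decomposition of `h 0`. (It is independent of the choice of the branch in `h`.) -/
def IsNormalizedSimpleFactor (r : ℝ) (l₀ : ℂ) (L : CP1) (g : ℂ → Mat2) : Prop :=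
  ∃ h : ℂ → Mat2, IsUnnormalizedSimpleFactor r l₀ L h ∧
    ∃ Q ∈ Matrix.specialUnitaryGroup (Fin 2) ℂ, PosTriangular (Q⁻¹ * h 0) ∧
      ∀ l ∈ closedBall (0 : ℂ) r, g l = Q⁻¹ * h l

/-- `g = W ψ` is a general simple factor with unitary part `W`, singularity `l₀` and line `L`. -/
def IsGeneralSimpleFactor (r : ℝ) (W : Mat2) (l₀ : ℂ) (L : CP1) (g : ℂ → Mat2) : Prop :=
  W ∈ Matrix.specialUnitaryGroup (Fin 2) ℂ ∧
    ∃ ψ : ℂ → Mat2, IsNormalizedSimpleFactor r l₀ L ψ ∧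
      ∀ l ∈ closedBall (0 : ℂ) r, g l = W * ψ l

end Bridge

end

/-! Write `g_k = A_k h_k` with `A_k` constant unitary and `h_k = simpleFactor s P_k`, `s² = f`.
Classical dressing says that the unitary factor of `g_k Φ_k` is `g_k F_k` times the inverse of a
simple factor whose line is `F_k(l₀)ᴴ L_k`, where `F_k` is the unitary factor of `Φ_k`. Since `L₂ =
U(l₀)ᴴ L₁` and `F₁⁻¹ U F₂ → 1` at `l₀`, the two new lines approach each other. The new quotients are
the old ones conjugated by asymptotically equal simple factors, which are bounded away from `l₀` and
its mirror image, so they still tend to `1`.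

The argument runs backwards: from given factorizations `g_k Φ_k = G_k C_k` it constructs
factorizations of `Φ_k` (`IsIwasawa.exists_undress`) and feeds them to the hypothesis. Neither
existence nor uniqueness of Iwasawa factorizations is needed.

The square root `s` lives only on the closed disc, but the product `h₁ X h₂⁻¹` involves only `s² =
f`; this is `dress`, which makes sense on the annulus. A compatible pair of lines cancels its pole
at `l₀` (`IsUnitaryLoop.exists_dress`), and unitarity then removes the one at the mirror image.

Closeness of the lines comes from `compl_mul_mul_eq_zero` and `tendsto_sub_of_mul_eq_zero`,
closeness of the QR normalizations from `tendsto_mul_conjTranspose`. The identities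
`conj_mul_dress_mul_eq` and `mul_inv_mul_inv_eq` reduce both limits to `tendstoUniformlyOn_dress`.
-/

noncomputable section

namespace Bridge

/-! ### Rank one orthogonal projections of `ℂ²` -/

/-- `P` is the matrix of the orthogonal projection onto a line of `ℂ²`. -/
structure IsLineProj (P : Mat2) : Prop where
  conjTranspose_eq : Pᴴ = P
  mul_self : P * P = P
  trace_eq : P.trace = 1

/-- Cayley–Hamilton. It replaces rank arguments below by trace and determinant computations. -/
theorem mul_self_eq_trace_smul_sub (M : Mat2) : M * M = M.trace • M - M.det • (1 : Mat2) := by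
  ext i j
  fin_cases i <;> fin_cases j <;>
    simp [Matrix.mul_apply, Fin.sum_univ_two, Matrix.trace_fin_two, Matrix.det_fin_two] <;> ring

theorem adjugate_eq_trace_smul_sub (M : Mat2) : M.adjugate = M.trace • (1 : Mat2) - M := by
  ext i j
  fin_cases i <;> fin_cases j <;>
    simp [Matrix.adjugate_fin_two, Matrix.trace_fin_two]

/-- In determinant one the inverse is polynomial in the entries, so limits pass through it freely.
-/
theorem inv_eq_adjugate {M : Mat2} (h : M.det = 1) : M⁻¹ = M.adjugate := by
  rw [Matrix.inv_def, h, Ring.inverse_one, one_smul]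

theorem isUnit_det_of_eq_one {M : Mat2} (h : M.det = 1) : IsUnit M.det := by
  rw [h]; exact isUnit_one

theorem mul_inv_of_det {M : Mat2} (h : M.det = 1) : M * M⁻¹ = 1 :=
  Matrix.mul_nonsing_inv _ (isUnit_det_of_eq_one h)

theorem inv_mul_of_det {M : Mat2} (h : M.det = 1) : M⁻¹ * M = 1 :=
  Matrix.nonsing_inv_mul _ (isUnit_det_of_eq_one h)

theorem det_inv_of_det {M : Mat2} (h : M.det = 1) : M⁻¹.det = 1 := by
  have := congrArg Matrix.det (mul_inv_of_det h)
  rwa [Matrix.det_mul, h, one_mul, Matrix.det_one] at this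

namespace IsLineProj

variable {P P' : Mat2}

theorem det_eq (hP : IsLineProj P) : P.det = 0 := by
  have h := mul_self_eq_trace_smul_sub P
  rw [hP.mul_self, hP.trace_eq, one_smul, eq_comm, sub_eq_self] at h
  simpa using congrFun (congrFun h 0) 0

theorem adjugate_eq (hP : IsLineProj P) : P.adjugate = 1 - P := by
  rw [adjugate_eq_trace_smul_sub, hP.trace_eq, one_smul]

theorem compl (hP : IsLineProj P) : IsLineProj (1 - P) where
  conjTranspose_eq := by rw [Matrix.conjTranspose_sub, hP.conjTranspose_eq, Matrix.conjTranspose_one]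
  mul_self := by rw [mul_sub, mul_one, sub_mul, one_mul, hP.mul_self, sub_self, sub_zero]
  trace_eq := by rw [Matrix.trace_sub, hP.trace_eq]; simp; norm_num

theorem adjugate_compl (hP : IsLineProj P) : (1 - P).adjugate = P := by
  rw [hP.compl.adjugate_eq, sub_sub_cancel]

theorem mul_compl (hP : IsLineProj P) : P * (1 - P) = 0 := by
  rw [mul_sub, hP.mul_self, mul_one, sub_self]

theorem compl_mul (hP : IsLineProj P) : (1 - P) * P = 0 := by
  rw [sub_mul, hP.mul_self, one_mul, sub_self]

theorem norm_le_one (hP : IsLineProj P) : ‖P‖ ≤ 1 :=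
  IsStarProjection.norm_le P ⟨hP.mul_self, hP.conjTranspose_eq⟩

/-- Conjugating a line projection by a unitary matrix yields a line projection. -/
theorem unitaryConj (hP : IsLineProj P) {K : Mat2} (hK : K ∈ Matrix.specialUnitaryGroup (Fin 2) ℂ) :
    IsLineProj (Kᴴ * P * K) := by
  have hK' : K * Kᴴ = 1 := (Matrix.mem_unitaryGroup_iff).1 hK.1
  refine ⟨?_, ?_, ?_⟩
  · simp [Matrix.conjTranspose_mul, hP.conjTranspose_eq, mul_assoc]
  · calc Kᴴ * P * K * (Kᴴ * P * K) = Kᴴ * P * (K * Kᴴ) * (P * K) := by simp only [mul_assoc]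
      _ = Kᴴ * (P * P) * K := by rw [hK']; simp only [mul_assoc, one_mul]
      _ = _ := by rw [hP.mul_self]
  · rw [Matrix.trace_mul_comm, ← mul_assoc, hK', one_mul, hP.trace_eq]

/-- Pulling back a line by the adjoint of an invertible matrix. -/
theorem exists_pullback (hP : IsLineProj P) {A : Mat2} (hA : A.det = 1) :
    ∃ R, IsLineProj R ∧ P * A * (1 - R) = 0 := by
  -- `M` is Hermitian of rank one with the same kernel as `P * A`; divided by its trace it is the
  -- projection sought.
  set M : Mat2 := Aᴴ * P * A with hM
  have hAH : Aᴴ.det = 1 := by rw [Matrix.det_conjTranspose, hA, star_one]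
  have hMsq : M * M = M.trace • M := by
    have h := mul_self_eq_trace_smul_sub M
    rwa [show M.det = 0 by simp [hM, hP.det_eq], zero_smul, sub_zero] at h
  have hMH : Mᴴ = M := by simp [hM, Matrix.conjTranspose_mul, hP.conjTranspose_eq, mul_assoc]
  have hM0 : M ≠ 0 := by
    intro h
    have : P = 0 := by
      calc P = (Aᴴ⁻¹ * Aᴴ) * P * (A * A⁻¹) := by
            rw [inv_mul_of_det hAH, mul_inv_of_det hA, one_mul, mul_one]
        _ = Aᴴ⁻¹ * M * A⁻¹ := by simp only [hM, mul_assoc]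
        _ = 0 := by rw [h, mul_zero, zero_mul]
    simpa [this] using hP.trace_eq
  -- A Hermitian matrix with square zero vanishes, by the C*-identity.
  have ht : M.trace ≠ 0 := by
    intro h
    rw [h, zero_smul] at hMsq
    apply hM0
    have h' : ‖M‖ * ‖M‖ = 0 := by
      rw [← Matrix.l2_opNorm_conjTranspose_mul_self, hMH, hMsq, norm_zero]
    exact norm_eq_zero.1 (mul_self_eq_zero.1 h')
  have htr : star M.trace = M.trace := by rw [← Matrix.trace_conjTranspose, hMH]
  refine ⟨M.trace⁻¹ • M, ⟨?_, ?_, ?_⟩, ?_⟩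
  · rw [Matrix.conjTranspose_smul, hMH, star_inv₀, htr]
  · rw [smul_mul_assoc, mul_smul_comm, hMsq, smul_smul, smul_smul, mul_assoc,
      inv_mul_cancel₀ ht, mul_one]
  · rw [Matrix.trace_smul, smul_eq_mul, inv_mul_cancel₀ ht]
  · have h : Aᴴ * (P * A * (1 - M.trace⁻¹ • M)) = 0 := by
      calc _ = M - M.trace⁻¹ • (M * M) := by
            rw [← mul_assoc, ← mul_assoc, mul_sub, mul_one, mul_smul_comm]
        _ = 0 := by rw [hMsq, smul_smul, inv_mul_cancel₀ ht, one_smul, sub_self]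
    have h2 := congrArg (Aᴴ⁻¹ * ·) h
    simpa only [← mul_assoc, inv_mul_of_det hAH, one_mul, mul_zero] using h2

/-- Two line projections are as close as the product `(1 - P) P'` is small. -/
theorem sub_eq (hP : IsLineProj P) (hP' : IsLineProj P') :
    P - P' = ((1 - P) * P').adjugate - ((1 - P) * P')ᴴ := by
  -- The right side becomes `(1 - P') * P - P' * (1 - P)`.
  rw [Matrix.adjugate_mul_distrib, hP'.adjugate_eq, hP.adjugate_compl, Matrix.conjTranspose_mul,
    hP'.conjTranspose_eq, hP.compl.conjTranspose_eq]
  noncomm_ring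

end IsLineProj

/-! ### Simple factors and dressing -/

/-- `s π_L + s⁻¹ π_{L^⊥}`. -/
def simpleFactor (s : ℂ) (P : Mat2) : Mat2 := s • P + s⁻¹ • (1 - P)

/-- The product `simpleFactor s P * X * simpleFactor s⁻¹ P'`, which depends only on `c = s ^ 2`. -/
def dress (c : ℂ) (P P' X : Mat2) : Mat2 :=
  P * X * P' + (1 - P) * X * (1 - P') + c • (P * X * (1 - P')) + c⁻¹ • ((1 - P) * X * P')

section Algebra

variable {s c : ℂ} {P P' K A X Y : Mat2}

theorem simpleFactor_mul_inv (hs : s ≠ 0) (hP : IsLineProj P) :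
    simpleFactor s P * simpleFactor s⁻¹ P = 1 := by
  simp only [simpleFactor, add_mul, mul_add, Matrix.smul_mul, Matrix.mul_smul, smul_smul, hP.mul_self,
    hP.mul_compl, hP.compl_mul, hP.compl.mul_self, inv_inv, inv_mul_cancel₀ hs, mul_inv_cancel₀ hs]
  simp

theorem simpleFactor_inv_mul (hs : s ≠ 0) (hP : IsLineProj P) :
    simpleFactor s⁻¹ P * simpleFactor s P = 1 := by
  simpa using simpleFactor_mul_inv (inv_ne_zero hs) hP

theorem simpleFactor_inv (hs : s ≠ 0) (hP : IsLineProj P) :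
    (simpleFactor s P)⁻¹ = simpleFactor s⁻¹ P :=
  Matrix.inv_eq_right_inv (simpleFactor_mul_inv hs hP)

theorem simpleFactor_compl : simpleFactor s (1 - P) = simpleFactor s⁻¹ P := by
  simp only [simpleFactor, inv_inv, sub_sub_cancel]
  exact add_comm _ _

theorem simpleFactor_neg : simpleFactor (-s) P = -simpleFactor s P := by
  simp only [simpleFactor, inv_neg, neg_smul, neg_add]

theorem det_simpleFactor (hs : s ≠ 0) (hP : IsLineProj P) : (simpleFactor s P).det = 1 := by
  have h1 := hP.trace_eq
  have h2 := hP.det_eq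
  rw [Matrix.trace_fin_two] at h1
  rw [Matrix.det_fin_two] at h2
  simp only [simpleFactor, Matrix.det_fin_two, Matrix.add_apply, Matrix.smul_apply,
    Matrix.sub_apply, smul_eq_mul, Matrix.one_apply_eq, ne_eq, zero_ne_one, one_ne_zero,
    not_false_eq_true, Matrix.one_apply_ne]
  have h3 : P 1 1 = 1 - P 0 0 := by linear_combination h1
  have h4 : P 0 1 * P 1 0 = P 0 0 * (1 - P 0 0) := by rw [← h3]; linear_combination -h2
  rw [h3]
  field_simp
  linear_combination (-(s ^ 4) + 2 * s ^ 2 - 1) * h4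

theorem simpleFactor_conj (hK : K ∈ Matrix.specialUnitaryGroup (Fin 2) ℂ) :
    Kᴴ * simpleFactor s P = simpleFactor s (Kᴴ * P * K) * Kᴴ := by
  have hK' : K * Kᴴ = 1 := (Matrix.mem_unitaryGroup_iff).1 hK.1
  simp only [simpleFactor, mul_add, add_mul, Matrix.mul_smul, Matrix.smul_mul, mul_sub, sub_mul,
    mul_assoc, hK', mul_one, one_mul]

theorem dress_sq (hs : s ≠ 0) :
    dress (s ^ 2) P P' X = simpleFactor s P * X * simpleFactor s⁻¹ P' := by
  simp only [dress, simpleFactor, inv_inv]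
  generalize 1 - P = Q
  generalize 1 - P' = Q'
  simp only [add_mul, mul_add, Matrix.smul_mul, Matrix.mul_smul, smul_smul, mul_inv_cancel₀ hs,
    inv_mul_cancel₀ hs, one_smul, ← sq, inv_pow]
  abel

/-- A pointwise root, with no continuity in `c`, is enough to derive identities for `dress` from its
factorization `dress_sq`. -/
theorem exists_sq_eq (hc : c ≠ 0) : ∃ s : ℂ, s ≠ 0 ∧ s ^ 2 = c := by
  obtain ⟨s, hs⟩ := IsAlgClosed.exists_pow_nat_eq c two_pos
  exact ⟨s, fun h => hc (by rw [← hs, h]; simp), hs⟩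

theorem det_dress (hc : c ≠ 0) (hP : IsLineProj P) (hP' : IsLineProj P') :
    (dress c P P' X).det = X.det := by
  obtain ⟨s, hs, rfl⟩ := exists_sq_eq hc
  rw [dress_sq hs, Matrix.det_mul, Matrix.det_mul, det_simpleFactor hs hP,
    det_simpleFactor (inv_ne_zero hs) hP', one_mul, mul_one]

theorem dress_mul_dress (hc : c ≠ 0) (hP' : IsLineProj P') {P'' : Mat2} :
    dress c P P' X * dress c P' P'' Y = dress c P P'' (X * Y) := by
  obtain ⟨s, hs, rfl⟩ := exists_sq_eq hc
  rw [dress_sq hs, dress_sq hs, dress_sq hs]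
  calc _ = simpleFactor s P * X * (simpleFactor s⁻¹ P' * simpleFactor s P') * Y
        * simpleFactor s⁻¹ P'' := by simp only [mul_assoc]
    _ = _ := by rw [simpleFactor_inv_mul hs hP']; simp only [mul_assoc, one_mul]

theorem dress_one (hc : c ≠ 0) (hP : IsLineProj P) : dress c P P 1 = 1 := by
  obtain ⟨s, hs, rfl⟩ := exists_sq_eq hc
  rw [dress_sq hs, mul_one, simpleFactor_mul_inv hs hP]

theorem dress_inv (hc : c ≠ 0) (hP : IsLineProj P) (hP' : IsLineProj P') (hX : X.det = 1) :
    (dress c P P' X)⁻¹ = dress c P' P X⁻¹ := by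
  apply Matrix.inv_eq_right_inv
  rw [dress_mul_dress hc hP', mul_inv_of_det hX, dress_one hc hP]

theorem dress_compl (c : ℂ) (P P' X : Mat2) : dress c (1 - P) (1 - P') X = dress c⁻¹ P P' X := by
  simp only [dress, sub_sub_cancel, inv_inv]
  abel

/-- Together with `ratMap_reflect` and `dress_inv`, this makes dressing preserve the reality
condition `X^* = X⁻¹`. -/
theorem conjTranspose_dress (hP : IsLineProj P) (hP' : IsLineProj P') :
    (dress c P P' X)ᴴ = dress (conj c)⁻¹ P' P Xᴴ := by
  simp only [dress, Matrix.conjTranspose_add, Matrix.conjTranspose_mul, Matrix.conjTranspose_smul,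
    hP.conjTranspose_eq, hP'.conjTranspose_eq, hP.compl.conjTranspose_eq,
    hP'.compl.conjTranspose_eq, inv_inv, star_inv₀, RCLike.star_def, mul_assoc]
  abel

end Algebra

/-! ### Special unitary and positive triangular matrices -/

section QR

variable {K N T T' : Mat2}

theorem conjTranspose_mul_of_mem (hK : K ∈ Matrix.specialUnitaryGroup (Fin 2) ℂ) : Kᴴ * K = 1 :=
  (Matrix.mem_unitaryGroup_iff').1 hK.1

theorem mul_conjTranspose_of_mem (hK : K ∈ Matrix.specialUnitaryGroup (Fin 2) ℂ) : K * Kᴴ = 1 :=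
  (Matrix.mem_unitaryGroup_iff).1 hK.1

theorem det_of_mem (hK : K ∈ Matrix.specialUnitaryGroup (Fin 2) ℂ) : K.det = 1 := hK.2

theorem inv_of_mem (hK : K ∈ Matrix.specialUnitaryGroup (Fin 2) ℂ) : K⁻¹ = Kᴴ :=
  Matrix.inv_eq_right_inv (mul_conjTranspose_of_mem hK)

theorem conjTranspose_mem (hK : K ∈ Matrix.specialUnitaryGroup (Fin 2) ℂ) :
    Kᴴ ∈ Matrix.specialUnitaryGroup (Fin 2) ℂ :=
  Matrix.mem_specialUnitaryGroup_iff.2 ⟨Unitary.star_mem (Matrix.mem_specialUnitaryGroup_iff.1 hK).1, by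
    rw [Matrix.det_conjTranspose, det_of_mem hK, star_one]⟩

theorem neg_mem_specialUnitaryGroup (hK : K ∈ Matrix.specialUnitaryGroup (Fin 2) ℂ) :
    -K ∈ Matrix.specialUnitaryGroup (Fin 2) ℂ := by
  refine ⟨Matrix.mem_unitaryGroup_iff.2 ?_, ?_⟩
  · rw [star_neg, neg_mul_neg]; exact mul_conjTranspose_of_mem hK
  · rw [SetLike.mem_coe, MonoidHom.mem_mker, Matrix.coe_detMonoidHom, Matrix.det_neg,
      det_of_mem hK]
    simp

theorem norm_of_mem (hK : K ∈ Matrix.specialUnitaryGroup (Fin 2) ℂ) : ‖K‖ = 1 :=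
  CStarRing.norm_of_mem_unitary hK.1

theorem PosTriangular.inv_eq (hT : PosTriangular T) :
    T⁻¹ = !![T 1 1, -T 0 1; 0, T 0 0] := by
  rw [inv_eq_adjugate hT.1, Matrix.adjugate_fin_two, hT.2.1, neg_zero]

theorem PosTriangular.inv (hT : PosTriangular T) : PosTriangular T⁻¹ := by
  refine ⟨det_inv_of_det hT.1, ?_, ?_⟩
  · simp [hT.inv_eq]
  · intro i
    rw [hT.inv_eq]
    fin_cases i
    · simpa using hT.2.2 1
    · simpa using hT.2.2 0

theorem PosTriangular.mul (hT : PosTriangular T) (hT' : PosTriangular T') :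
    PosTriangular (T * T') := by
  obtain ⟨h1, h2, h3⟩ := hT
  obtain ⟨h1', h2', h3'⟩ := hT'
  refine ⟨by rw [Matrix.det_mul, h1, h1', one_mul], ?_, ?_⟩
  · simp [Matrix.mul_apply, Fin.sum_univ_two, h2, h2']
  · intro i
    have a := h3 i
    have b := h3' i
    have : (T * T') i i = T i i * T' i i := by
      fin_cases i <;> simp [Matrix.mul_apply, Fin.sum_univ_two, h2, h2']
    rw [this, Complex.mul_im, Complex.mul_re, a.1, b.1]
    exact ⟨by ring, by nlinarith [mul_pos a.2 b.2]⟩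

/-- Existence of the QR-decomposition. -/
theorem exists_qr (hT : T.det = 1) :
    ∃ Q ∈ Matrix.specialUnitaryGroup (Fin 2) ℂ, PosTriangular (Q⁻¹ * T) := by
  set m : ℝ := Complex.normSq (T 0 0) + Complex.normSq (T 1 0) with hm
  have hm0 : 0 < m := by
    have h1 := Complex.normSq_nonneg (T 0 0)
    have h2 := Complex.normSq_nonneg (T 1 0)
    refine lt_of_le_of_ne (add_nonneg h1 h2) fun h => ?_
    have h3 : T 0 0 = 0 := Complex.normSq_eq_zero.1 (by linarith)
    have h4 : T 1 0 = 0 := Complex.normSq_eq_zero.1 (by linarith)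
    rw [Matrix.det_fin_two, h3, h4] at hT
    simp at hT
  set n : ℝ := √m with hn
  have hn0 : 0 < n := Real.sqrt_pos.2 hm0
  have hn2 : (n : ℂ) * n = T 0 0 * conj (T 0 0) + T 1 0 * conj (T 1 0) := by
    rw [Complex.mul_conj, Complex.mul_conj, ← Complex.ofReal_mul, ← Complex.ofReal_add,
      Real.mul_self_sqrt hm0.le]
  have hnC : (n : ℂ) ≠ 0 := Complex.ofReal_ne_zero.2 hn0.ne'
  rw [Matrix.det_fin_two] at hT
  -- Gram–Schmidt: the first column of `T` divided by its length `n`, completed to an element of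
  -- `SU(2)`.
  set Q : Mat2 := !![T 0 0 / n, -conj (T 1 0) / n; T 1 0 / n, conj (T 0 0) / n] with hQ
  have hQH : Qᴴ = !![conj (T 0 0) / n, conj (T 1 0) / n; -T 1 0 / n, T 0 0 / n] := by
    ext i j
    fin_cases i <;> fin_cases j <;> simp [hQ]
  have hmem : Q ∈ Matrix.specialUnitaryGroup (Fin 2) ℂ := by
    refine Matrix.mem_specialUnitaryGroup_iff.2 ⟨Matrix.mem_unitaryGroup_iff.2 ?_, ?_⟩
    · rw [Matrix.star_eq_conjTranspose, hQH, hQ, Matrix.mul_fin_two, Matrix.one_fin_two]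
      ext i j
      fin_cases i <;> fin_cases j <;> simp <;> field_simp
      · linear_combination -hn2
      · ring
      · ring
      · linear_combination -hn2
    · rw [hQ, Matrix.det_fin_two_of]
      field_simp
      linear_combination -hn2
  have hQT : Q⁻¹ * T = !![(n : ℂ), (conj (T 0 0) * T 0 1 + conj (T 1 0) * T 1 1) / n; 0,
      ((n⁻¹ : ℝ) : ℂ)] := by
    rw [inv_of_mem hmem, hQH]
    ext i j
    fin_cases i <;> fin_cases j <;> simp [Matrix.mul_apply, Fin.sum_univ_two] <;> field_simp
    · linear_combination -hn2
    · ring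
    · linear_combination hT
  refine ⟨Q, hmem, ?_, ?_, ?_⟩
  · rw [hQT, Matrix.det_fin_two_of]; simp [hnC]
  · rw [hQT]; simp
  · rw [hQT]
    intro i
    fin_cases i
    · simpa using hn0
    · simpa [← Complex.ofReal_inv] using hn0

theorem specialUnitary_entries (hK : K ∈ Matrix.specialUnitaryGroup (Fin 2) ℂ) :
    K 1 1 = conj (K 0 0) ∧ K 0 1 = -conj (K 1 0) := by
  have h := inv_eq_adjugate (det_of_mem hK)
  rw [inv_of_mem hK, Matrix.adjugate_fin_two] at h
  have h1 := congrFun (congrFun h 0) 0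
  have h2 := congrFun (congrFun h 0) 1
  simp only [Matrix.conjTranspose_apply, Matrix.of_apply, Matrix.cons_val', Matrix.cons_val_zero,
    Matrix.cons_val_one, Matrix.cons_val_fin_one, RCLike.star_def] at h1 h2
  exact ⟨h1.symm, by rw [h2, neg_neg]⟩

/-- Special unitary matrices that are asymptotically positive triangular tend to the identity. -/
theorem tendsto_one_of_sub_posTriangular {E : Type*} {l : Filter E} {N T : E → Mat2}
    (hN : ∀ p, N p ∈ Matrix.specialUnitaryGroup (Fin 2) ℂ) (hT : ∀ p, PosTriangular (T p))
    (h : Tendsto (fun p => T p - N p) l (𝓝 0)) : Tendsto N l (𝓝 1) := by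
  have hent : ∀ i j, Tendsto (fun p => T p i j - N p i j) l (𝓝 0) := fun i j =>
    ((continuous_id.matrix_elem i j).tendsto (0 : Mat2)).comp h
  have h10 : Tendsto (fun p => N p 1 0) l (𝓝 0) := by
    simpa [(hT _).2.1] using (hent 1 0).neg
  have him : Tendsto (fun p => (N p 0 0).im) l (𝓝 0) := by
    have := (Complex.continuous_im.tendsto _).comp (hent 0 0)
    simpa [Function.comp_def, ((hT _).2.2 0).1] using this.neg
  -- Positivity of `T 0 0` is what rules out the limit `-1`.
  have hre0 : ∀ᶠ p in l, -(1 / 2) < (N p 0 0).re := by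
    have := (Complex.continuous_re.tendsto _).comp (hent 0 0)
    filter_upwards [this.eventually (gt_mem_nhds (show (0 : ℂ).re < 1 / 2 by norm_num))] with p hp
    have := ((hT p).2.2 0).2
    simp only [Function.comp_apply, Complex.sub_re] at hp
    linarith
  have hdet : ∀ p, (N p 0 0).re ^ 2 + (N p 0 0).im ^ 2 + ‖N p 1 0‖ ^ 2 = 1 := by
    intro p
    have h1 := det_of_mem (hN p)
    rw [Matrix.det_fin_two, (specialUnitary_entries (hN p)).1, (specialUnitary_entries (hN p)).2,
      Complex.mul_conj, neg_mul, mul_comm (conj _), Complex.mul_conj] at h1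
    rw [sub_neg_eq_add] at h1
    have h2 : Complex.normSq (N p 0 0) + Complex.normSq (N p 1 0) = 1 := by exact_mod_cast h1
    rw [← Complex.normSq_eq_norm_sq, ← h2, Complex.normSq_apply (N p 0 0)]
    ring
  have hre : Tendsto (fun p => (N p 0 0).re) l (𝓝 1) := by
    -- By `hdet`, `(1 - re)(1 + re) = im² + ‖N 1 0‖²`, and `1 + re > 1/2` accounts for the factor
    -- `2`.
    have hb : Tendsto (fun p => 2 * ((N p 0 0).im ^ 2 + ‖N p 1 0‖ ^ 2)) l (𝓝 0) := by
      have := ((him.pow 2).add (h10.norm.pow 2)).const_mul 2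
      simpa using this
    rw [tendsto_iff_dist_tendsto_zero]
    refine squeeze_zero' (Eventually.of_forall fun _ => dist_nonneg) ?_ hb
    filter_upwards [hre0] with p hp
    have h1 := hdet p
    have h2 : (N p 0 0).re ≤ 1 := by nlinarith [sq_nonneg (N p 0 0).im, sq_nonneg ‖N p 1 0‖]
    rw [Real.dist_eq, abs_sub_comm, abs_of_nonneg (by linarith)]
    nlinarith
  have h00 : Tendsto (fun p => N p 0 0) l (𝓝 1) := by
    have := ((Complex.continuous_ofReal.tendsto _).comp hre).add
      (((Complex.continuous_ofReal.tendsto _).comp him).mul_const Complex.I)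
    simpa [Function.comp_def, Complex.re_add_im] using this
  have h11 : Tendsto (fun p => N p 1 1) l (𝓝 1) := by
    simp_rw [fun p => (specialUnitary_entries (hN p)).1]
    simpa [Function.comp_def] using (Complex.continuous_conj.tendsto _).comp h00
  have h01 : Tendsto (fun p => N p 0 1) l (𝓝 0) := by
    simp_rw [fun p => (specialUnitary_entries (hN p)).2]
    simpa [Function.comp_def] using ((Complex.continuous_conj.tendsto _).comp h10).neg
  refine tendsto_pi_nhds.2 fun i => tendsto_pi_nhds.2 fun j => ?_
  fin_cases i <;> fin_cases j
  · simpa using h00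
  · simpa using h01
  · simpa using h10
  · simpa using h11

end QR

/-! ### Estimates for dressing -/

section Estimates

theorem norm_dress_le {c : ℂ} {P P' X : Mat2} (hP : IsLineProj P) (hP' : IsLineProj P') :
    ‖dress c P P' X‖ ≤ (2 + ‖c‖ + ‖c⁻¹‖) * ‖X‖ := by
  have key : ∀ A B : Mat2, ‖A‖ ≤ 1 → ‖B‖ ≤ 1 → ‖A * X * B‖ ≤ ‖X‖ := fun A B hA hB =>
    calc ‖A * X * B‖ ≤ ‖A‖ * ‖X‖ * ‖B‖ :=
          (norm_mul_le _ _).trans (by gcongr; exact norm_mul_le _ _)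
      _ ≤ 1 * ‖X‖ * 1 := by gcongr
      _ = ‖X‖ := by ring
  have h1 := hP.norm_le_one
  have h2 := hP'.norm_le_one
  have h3 := hP.compl.norm_le_one
  have h4 := hP'.compl.norm_le_one
  unfold dress
  calc _ ≤ ‖P * X * P'‖ + ‖(1 - P) * X * (1 - P')‖ + ‖c • (P * X * (1 - P'))‖
        + ‖c⁻¹ • ((1 - P) * X * P')‖ := norm_add₄_le
    _ ≤ ‖X‖ + ‖X‖ + ‖c‖ * ‖X‖ + ‖c⁻¹‖ * ‖X‖ := by
        rw [norm_smul, norm_smul]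
        gcongr <;> exact key _ _ ‹_› ‹_›
    _ = _ := by ring

/-- Compared with `dress c P P 1 = 1`, the error splits into a dressed `X - 1` and four terms linear
in `P - P'`. -/
theorem norm_dress_sub_one_le {c : ℂ} {P P' X : Mat2} (hc : c ≠ 0) (hP : IsLineProj P)
    (hP' : IsLineProj P') :
    ‖dress c P P' X - 1‖ ≤ (2 + ‖c‖ + ‖c⁻¹‖) * (‖X - 1‖ + ‖P - P'‖) := by
  have h : dress c P P' X - dress c P P 1 = dress c P P' (X - 1)
      + (P * (P' - P) + (1 - P) * (P - P') + c • (P * (P - P')) + c⁻¹ • ((1 - P) * (P' - P))) := by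
    simp only [dress, mul_sub, sub_mul, smul_sub, mul_one, one_mul, hP.mul_self]
    abel
  have h1 := hP.norm_le_one
  have h2 := hP.compl.norm_le_one
  have key : ∀ A B : Mat2, ‖A‖ ≤ 1 → ‖A * B‖ ≤ ‖B‖ := fun A B hA =>
    (norm_mul_le _ _).trans (mul_le_of_le_one_left (norm_nonneg _) hA)
  rw [dress_one hc hP] at h
  rw [h, mul_add]
  refine (norm_add_le _ _).trans (add_le_add (norm_dress_le hP hP') ?_)
  calc _ ≤ ‖P * (P' - P)‖ + ‖(1 - P) * (P - P')‖ + ‖c • (P * (P - P'))‖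
        + ‖c⁻¹ • ((1 - P) * (P' - P))‖ := norm_add₄_le
    _ ≤ ‖P' - P‖ + ‖P - P'‖ + ‖c‖ * ‖P - P'‖ + ‖c⁻¹‖ * ‖P' - P‖ := by
        rw [norm_smul, norm_smul]
        gcongr <;> exact key _ _ ‹_›
    _ = _ := by rw [norm_sub_rev P' P]; ring

variable {E : Type*} {l : Filter E} {P P' K K' : E → Mat2}

/-- The hypothesis gives `(1 - P) P' = (1 - P)(1 - X) P'`, which is small, and `IsLineProj.sub_eq`
recovers `P - P'` from it. -/
theorem tendsto_sub_of_mul_eq_zero {X : E → Mat2}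
    (hP : ∀ p, IsLineProj (P p)) (hP' : ∀ p, IsLineProj (P' p)) (hX : Tendsto X l (𝓝 1))
    (h : ∀ p, (1 - P p) * X p * P' p = 0) : Tendsto (fun p => P p - P' p) l (𝓝 0) := by
  have he : Tendsto (fun p => (1 - P p) * P' p) l (𝓝 0) := by
    have hX0 : Tendsto (fun p => ‖1 - X p‖) l (𝓝 0) := by
      simpa using (tendsto_const_nhds (x := (1 : Mat2)).sub hX).norm
    refine squeeze_zero_norm (fun p => ?_) hX0
    calc ‖(1 - P p) * P' p‖ = ‖(1 - P p) * (1 - X p) * P' p‖ := by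
          rw [mul_sub (1 - P p) 1 (X p), sub_mul ((1 - P p) * 1) _ (P' p), h p, sub_zero,
            Matrix.mul_one]
      _ ≤ ‖1 - P p‖ * ‖1 - X p‖ * ‖P' p‖ :=
          (norm_mul_le _ _).trans (by gcongr; exact norm_mul_le _ _)
      _ ≤ 1 * ‖1 - X p‖ * 1 := by
          gcongr
          exacts [(hP p).compl.norm_le_one, (hP' p).norm_le_one]
      _ = _ := by ring
  simp_rw [fun p => (hP p).sub_eq (hP' p)]
  have hc : Continuous fun M : Mat2 => M.adjugate - Mᴴ :=
    continuous_id.matrix_adjugate.sub continuous_id.matrix_conjTranspose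
  simpa [Function.comp_def, Matrix.adjugate_zero] using (hc.tendsto 0).comp he

/-- If `K` and `K'` normalize asymptotically equal simple factors, then they are asymptotically
equal. -/
theorem tendsto_mul_conjTranspose {s : ℂ} (hs : s ≠ 0)
    (hP : ∀ p, IsLineProj (P p)) (hP' : ∀ p, IsLineProj (P' p))
    (hK : ∀ p, K p ∈ Matrix.specialUnitaryGroup (Fin 2) ℂ)
    (hK' : ∀ p, K' p ∈ Matrix.specialUnitaryGroup (Fin 2) ℂ)
    (h : Tendsto (fun p => P p - P' p) l (𝓝 0))
    (hT : ∀ p, PosTriangular (simpleFactor s (P p) * (K p)ᴴ))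
    (hT' : ∀ p, PosTriangular (simpleFactor s (P' p) * (K' p)ᴴ)) :
    Tendsto (fun p => K p * (K' p)ᴴ) l (𝓝 1) := by
  -- The quotient of the two triangular matrices is `K (h⁻¹ h') K'ᴴ`, and `h⁻¹ h'` is a dressed
  -- identity, close to `1`. So `K K'ᴴ` is asymptotically positive triangular.
  refine tendsto_one_of_sub_posTriangular (T := fun p => (simpleFactor s (P p) * (K p)ᴴ)⁻¹ *
    (simpleFactor s (P' p) * (K' p)ᴴ)) (fun p => mul_mem (hK p) (conjTranspose_mem (hK' p)))
    (fun p => (hT p).inv.mul (hT' p)) ?_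
  have hb : Tendsto (fun p => (2 + ‖(s⁻¹) ^ 2‖ + ‖((s⁻¹) ^ 2)⁻¹‖) * ‖P p - P' p‖) l (𝓝 0) := by
    have := h.norm.const_mul (2 + ‖(s⁻¹) ^ 2‖ + ‖((s⁻¹) ^ 2)⁻¹‖)
    rwa [norm_zero, mul_zero] at this
  refine squeeze_zero_norm (fun p => ?_) hb
  have hi : (simpleFactor s (P p) * (K p)ᴴ)⁻¹ = K p * simpleFactor s⁻¹ (P p) := by
    apply Matrix.inv_eq_right_inv
    rw [mul_assoc, ← mul_assoc (K p)ᴴ, conjTranspose_mul_of_mem (hK p), one_mul,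
      simpleFactor_mul_inv hs (hP p)]
  have hD := dress_sq (P := P p) (P' := P' p) (X := 1) (inv_ne_zero hs)
  rw [inv_inv, mul_one] at hD
  have hEq : (simpleFactor s (P p) * (K p)ᴴ)⁻¹ * (simpleFactor s (P' p) * (K' p)ᴴ)
      - K p * (K' p)ᴴ = K p * (dress (s⁻¹ ^ 2) (P p) (P' p) 1 - 1) * (K' p)ᴴ := by
    rw [hi, hD]
    noncomm_ring
  rw [hEq]
  calc _ ≤ ‖K p‖ * ‖dress (s⁻¹ ^ 2) (P p) (P' p) 1 - 1‖ * ‖(K' p)ᴴ‖ :=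
        (norm_mul_le _ _).trans (by gcongr; exact norm_mul_le _ _)
    _ = ‖dress (s⁻¹ ^ 2) (P p) (P' p) 1 - 1‖ := by
        rw [norm_of_mem (hK p), norm_of_mem (conjTranspose_mem (hK' p)), one_mul, mul_one]
    _ ≤ _ := by
        have := norm_dress_sub_one_le (X := 1) (pow_ne_zero 2 (inv_ne_zero hs)) (hP p) (hP' p)
        simpa using this

/-- Dressing with asymptotically equal simple factors preserves uniform convergence to the
identity. -/
theorem tendstoUniformlyOn_dress {X : E → ℂ → Mat2} {R : Set ℂ} {φ : ℂ → ℂ} {C : ℝ}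
    (hφ : ∀ x ∈ R, φ x ≠ 0 ∧ ‖φ x‖ ≤ C ∧ ‖(φ x)⁻¹‖ ≤ C)
    (hP : ∀ p, IsLineProj (P p)) (hP' : ∀ p, IsLineProj (P' p))
    (hK : ∀ p, K p ∈ Matrix.specialUnitaryGroup (Fin 2) ℂ)
    (hK' : ∀ p, K' p ∈ Matrix.specialUnitaryGroup (Fin 2) ℂ)
    (h : Tendsto (fun p => P p - P' p) l (𝓝 0))
    (hKK' : Tendsto (fun p => K p * (K' p)ᴴ) l (𝓝 1))
    (hX : TendstoUniformlyOn X (fun _ => 1) l R) :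
    TendstoUniformlyOn (fun p x => K p * dress (φ x) (P p) (P' p) (X p x) * (K' p)ᴴ)
      (fun _ => 1) l R := by
  rcases R.eq_empty_or_nonempty with rfl | ⟨x₀, hx₀⟩
  · exact tendstoUniformlyOn_empty
  have hC : 0 ≤ C := (norm_nonneg _).trans (hφ x₀ hx₀).2.1
  rw [Metric.tendstoUniformlyOn_iff] at hX ⊢
  intro ε hε
  -- Chosen so that `(2 + 2C)(η + η) = ε / 2`.
  set η : ℝ := ε / (4 * (2 + C + C)) with hη
  have hη0 : 0 < η := by positivity
  have hKd : Tendsto (fun p => ‖K p * (K' p)ᴴ - 1‖) l (𝓝 0) := by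
    simpa using (hKK'.sub_const 1).norm
  have hPd : Tendsto (fun p => ‖P p - P' p‖) l (𝓝 0) := by simpa using h.norm
  filter_upwards [hX η hη0, hKd.eventually (gt_mem_nhds (half_pos hε)),
    hPd.eventually (gt_mem_nhds hη0)] with p h1 h2 h3 x hx
  obtain ⟨hx0, hx1, hx2⟩ := hφ x hx
  have h1x := h1 x hx
  rw [dist_comm, dist_eq_norm] at h1x ⊢
  have hEq : K p * dress (φ x) (P p) (P' p) (X p x) * (K' p)ᴴ - 1 =
      K p * (dress (φ x) (P p) (P' p) (X p x) - 1) * (K' p)ᴴ + (K p * (K' p)ᴴ - 1) := by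
    noncomm_ring
  rw [hEq]
  calc _ ≤ ‖K p * (dress (φ x) (P p) (P' p) (X p x) - 1) * (K' p)ᴴ‖ + ‖K p * (K' p)ᴴ - 1‖ :=
        norm_add_le _ _
    _ ≤ ‖dress (φ x) (P p) (P' p) (X p x) - 1‖ + ‖K p * (K' p)ᴴ - 1‖ := by
        gcongr
        calc _ ≤ ‖K p‖ * ‖dress (φ x) (P p) (P' p) (X p x) - 1‖ * ‖(K' p)ᴴ‖ :=
              (norm_mul_le _ _).trans (by gcongr; exact norm_mul_le _ _)
          _ = _ := by
              rw [norm_of_mem (hK p), norm_of_mem (conjTranspose_mem (hK' p)), one_mul, mul_one]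
    _ ≤ (2 + C + C) * (η + η) + ‖K p * (K' p)ᴴ - 1‖ := by
        gcongr
        refine (norm_dress_sub_one_le hx0 (hP p) (hP' p)).trans ?_
        gcongr
    _ = ε / 2 + ‖K p * (K' p)ᴴ - 1‖ := by
        congr 1
        rw [hη]
        field_simp
        ring
    _ < ε := by linarith

end Estimates

/-! ### The annulus and the rational map of degree one -/

section RatMap

variable {r : ℝ} {l₀ l : ℂ}

theorem isOpen_annulus (r : ℝ) : IsOpen (annulus r) :=
  (isOpen_lt continuous_const continuous_norm).inter (isOpen_lt continuous_norm continuous_const)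

theorem norm_reflect (l : ℂ) : ‖reflect l‖ = ‖l‖⁻¹ := by simp [reflect]

theorem reflect_reflect (l : ℂ) : reflect (reflect l) = l := by simp [reflect]

theorem ne_zero_of_mem_annulus (hr : 0 < r) (hl : l ∈ annulus r) : l ≠ 0 :=
  norm_pos_iff.1 (hr.trans hl.1)

theorem reflect_mem_annulus (hr : 0 < r) (hl : l ∈ annulus r) : reflect l ∈ annulus r := by
  have h0 : 0 < ‖l‖ := hr.trans hl.1
  constructor
  · rw [norm_reflect, lt_inv_comm₀ hr h0, ← one_div]
    exact hl.2
  · rw [norm_reflect, one_div]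
    exact inv_strictAnti₀ hr hl.1

theorem continuousAt_reflect (hl : l ≠ 0) : ContinuousAt reflect l := by
  unfold reflect
  exact continuousAt_const.div Complex.continuous_conj.continuousAt (by simpa using hl)

theorem tendsto_reflect_nhdsNE (hl : l ≠ 0) : Tendsto reflect (𝓝[≠] (reflect l)) (𝓝[≠] l) := by
  have hl' : reflect l ≠ 0 := by simpa [reflect] using hl
  have h := (continuousAt_reflect hl').tendsto
  rw [reflect_reflect] at h
  refine tendsto_nhdsWithin_iff.2 ⟨h.mono_left nhdsWithin_le_nhds, ?_⟩
  filter_upwards [self_mem_nhdsWithin] with w hw hwl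
  exact hw (by rw [Set.mem_singleton_iff, ← (hwl : reflect w = l), reflect_reflect])

theorem one_sub_ne_zero (h₁ : ‖l₀‖ < 1) : 1 - l₀ ≠ 0 := fun h => by
  rw [← sub_eq_zero.1 h, norm_one] at h₁
  exact lt_irrefl _ h₁

theorem one_sub_conj_ne_zero (h₁ : ‖l₀‖ < 1) : 1 - conj l₀ ≠ 0 :=
  one_sub_ne_zero (by rwa [RCLike.norm_conj])

theorem one_sub_conj_mul (h₀ : l₀ ≠ 0) (l : ℂ) :
    1 - conj l₀ * l = -conj l₀ * (l - reflect l₀) := by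
  have : conj l₀ ≠ 0 := by simpa using h₀
  unfold reflect
  field_simp
  ring

theorem one_sub_conj_mul_ne_zero (h₀ : l₀ ≠ 0) (hl : l ≠ reflect l₀) : 1 - conj l₀ * l ≠ 0 := by
  rw [one_sub_conj_mul h₀]
  exact mul_ne_zero (by simpa using h₀) (sub_ne_zero.2 hl)

theorem ratMap_ne_zero (h₀ : l₀ ≠ 0) (h₁ : ‖l₀‖ < 1) (hl : l ≠ l₀) (hl' : l ≠ reflect l₀) :
    ratMap l₀ l ≠ 0 :=
  mul_ne_zero (div_ne_zero (one_sub_ne_zero h₁) (one_sub_conj_ne_zero h₁))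
    (div_ne_zero (one_sub_conj_mul_ne_zero h₀ hl') (sub_ne_zero.2 hl))

theorem analyticAt_ratMap (hl : l ≠ l₀) : AnalyticAt ℂ (ratMap l₀) l := by
  unfold ratMap
  have : l - l₀ ≠ 0 := sub_ne_zero.2 hl
  fun_prop (disch := assumption)

theorem ratMap_inv (l₀ l : ℂ) : (ratMap l₀ l)⁻¹ =
    (1 - conj l₀) / (1 - l₀) * ((l - l₀) / (1 - conj l₀ * l)) := by
  rw [ratMap, mul_inv, inv_div, inv_div]

theorem analyticAt_ratMap_inv (h₀ : l₀ ≠ 0) (hl : l ≠ reflect l₀) :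
    AnalyticAt ℂ (fun x => (ratMap l₀ x)⁻¹) l := by
  simp_rw [ratMap_inv]
  have : 1 - conj l₀ * l ≠ 0 := one_sub_conj_mul_ne_zero h₀ hl
  fun_prop (disch := assumption)

theorem meromorphicAt_ratMap (l₀ l : ℂ) : MeromorphicAt (ratMap l₀) l := by
  unfold ratMap
  fun_prop

/-- This is `f^* = f⁻¹`. With division by zero equal to zero it also holds at the pole and the zero
of `f`. -/
theorem ratMap_reflect (l₀ : ℂ) (hl : l ≠ 0) :
    (conj (ratMap l₀ (reflect l)))⁻¹ = ratMap l₀ l := by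
  have h : (1 - l₀ * l⁻¹) / (l⁻¹ - conj l₀) = (l - l₀) / (1 - conj l₀ * l) := by
    rw [← mul_div_mul_right _ _ hl, sub_mul, sub_mul, mul_assoc, inv_mul_cancel₀ hl, one_mul,
      mul_one]
  simp only [ratMap, reflect, one_div, map_mul, map_div₀, map_sub, map_one, Complex.conj_conj,
    map_inv₀, h, mul_inv, inv_div]

/-- The rational map and its inverse are bounded on bounded sets away from their poles. -/
theorem exists_ratMap_bound (h₀ : l₀ ≠ 0) (h₁ : ‖l₀‖ < 1) {δ : ℝ} (hδ : 0 < δ) (M : ℝ) :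
    ∃ C, ∀ l : ℂ, ‖l‖ ≤ M → δ ≤ dist l l₀ → δ ≤ dist l (reflect l₀) →
      ratMap l₀ l ≠ 0 ∧ ‖ratMap l₀ l‖ ≤ C ∧ ‖(ratMap l₀ l)⁻¹‖ ≤ C := by
  set C₁ : ℝ := ‖(1 - l₀) / (1 - conj l₀)‖ * ((1 + ‖l₀‖ * M) / δ)
  set C₂ : ℝ := ‖(1 - conj l₀) / (1 - l₀)‖ * ((M + ‖l₀‖) / (‖l₀‖ * δ))
  have hn : 0 < ‖l₀‖ := norm_pos_iff.2 h₀
  refine ⟨max C₁ C₂, fun l hM hd hd' => ⟨?_, ?_, ?_⟩⟩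
  · refine ratMap_ne_zero h₀ h₁ ?_ ?_
    · rintro rfl; rw [dist_self] at hd; linarith
    · rintro rfl; rw [dist_self] at hd'; linarith
  · refine le_max_of_le_left ?_
    rw [ratMap, norm_mul, norm_div (1 - conj l₀ * l)]
    have hM0 : 0 ≤ M := (norm_nonneg _).trans hM
    rw [dist_eq_norm] at hd
    refine mul_le_mul_of_nonneg_left ?_ (norm_nonneg _)
    refine div_le_div₀ (by positivity) ?_ hδ hd
    refine (norm_sub_le _ _).trans ?_
    rw [norm_one, norm_mul, RCLike.norm_conj]
    gcongr
  · refine le_max_of_le_right ?_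
    rw [ratMap_inv, norm_mul, norm_div (l - l₀), one_sub_conj_mul h₀, norm_mul, norm_neg,
      RCLike.norm_conj]
    have hM0 : 0 ≤ M := (norm_nonneg _).trans hM
    rw [dist_eq_norm] at hd'
    refine mul_le_mul_of_nonneg_left ?_ (norm_nonneg _)
    refine div_le_div₀ (by positivity) ?_ (by positivity) (by gcongr)
    exact (norm_sub_le _ _).trans (by gcongr)

end RatMap

/-! ### Unitary and meromorphic unitary loops -/

theorem analyticAt_of_notMem_sing {r : ℝ} {X : ℂ → Mat2} {l : ℂ}
    (hX : MeromorphicNFOn X (annulus r)) (hl : l ∈ annulus r) (hs : l ∉ sing r X) :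
    AnalyticAt ℂ X l :=
  (hX hl).meromorphicOrderAt_nonneg_iff_analyticAt.1 (not_lt.1 fun h => hs ⟨hl, h⟩)

theorem eventually_notMem_sing {r : ℝ} {X : ℂ → Mat2} {l : ℂ}
    (hX : MeromorphicNFOn X (annulus r)) (hl : l ∈ annulus r) :
    ∀ᶠ m in 𝓝[≠] l, m ∈ annulus r ∧ m ∉ sing r X := by
  have h := (hX hl).meromorphicAt.eventually_analyticAt
  filter_upwards [h, nhdsWithin_le_nhds ((isOpen_annulus r).mem_nhds hl)] with m hm hm'
  exact ⟨hm', fun hs => not_lt.2 hm.meromorphicOrderAt_nonneg hs.2⟩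

theorem sing_eq_empty {r : ℝ} {X : ℂ → Mat2} (hX : DifferentiableOn ℂ X (annulus r)) :
    sing r X = ∅ := by
  ext l
  simp only [sing, Set.mem_ofPred_eq, Set.mem_empty_iff_false, iff_false, not_and, not_lt]
  exact fun hl => (hX.analyticAt ((isOpen_annulus r).mem_nhds hl)).meromorphicOrderAt_nonneg

theorem IsUnitaryLoop.isMeroUnitaryLoop {r : ℝ} {X : ℂ → Mat2} (hX : IsUnitaryLoop r X) :
    IsMeroUnitaryLoop r X where
  loop := hX.loop
  mero := fun _ hl =>
    (hX.holo.analyticAt ((isOpen_annulus r).mem_nhds hl)).meromorphicNFAt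
  boundary := hX.boundary
  det_eq := fun l hl => hX.det_eq l hl.1
  unitary := fun l hl => hX.unitary l hl.1

theorem IsMeroUnitaryLoop.isUnitaryLoop {r : ℝ} {X : ℂ → Mat2} (hX : IsMeroUnitaryLoop r X)
    (h : sing r X = ∅) : IsUnitaryLoop r X where
  loop := hX.loop
  holo := fun l hl => (analyticAt_of_notMem_sing hX.mero hl (by simp [h])).differentiableAt
    |>.differentiableWithinAt
  boundary := hX.boundary
  det_eq := fun l hl => hX.det_eq l ⟨hl, by simp [h]⟩
  unitary := fun l hl => hX.unitary l ⟨hl, by simp [h]⟩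

/-- In normal form the value at a pole is `0`. A pole opposite a regular point would thus make the
inverse at that point zero, against determinant one. -/
theorem IsMeroUnitaryLoop.reflect_notMem_sing {r : ℝ} {X : ℂ → Mat2} (hX : IsMeroUnitaryLoop r X)
    {l : ℂ} (hl : l ∈ annulus r \ sing r X) : reflect l ∉ sing r X := by
  intro hs
  have h0 : X (reflect l) = 0 := by
    rcases meromorphicNFAt_iff_analyticAt_or.1 (hX.mero hs.1) with h | ⟨_, _, h⟩
    · exact absurd hs.2 (not_lt.2 h.meromorphicOrderAt_nonneg)
    · exact h
  have h1 := det_inv_of_det (hX.det_eq l hl)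
  rw [← hX.unitary l hl, h0] at h1
  simp at h1

theorem IsUnitaryLoop.const_mul {r : ℝ} {X : ℂ → Mat2} (hX : IsUnitaryLoop r X) {A : Mat2}
    (hA : A ∈ Matrix.specialUnitaryGroup (Fin 2) ℂ) : IsUnitaryLoop r (fun l => A * X l) where
  loop := by
    obtain ⟨h1, Y, hY, hXY⟩ := hX.loop
    refine ⟨fun l hl => by rw [Matrix.det_mul, det_of_mem hA, h1 l hl, one_mul],
      fun l => A * Y l, fun l hl => analyticAt_const.mul (hY l hl), fun l hl => ?_⟩
    simp only [hXY hl]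
  holo := hX.holo.const_mul A
  boundary := fun l hl => (hX.boundary l hl).const_mul A
  det_eq := fun l hl => by rw [Matrix.det_mul, det_of_mem hA, hX.det_eq l hl, one_mul]
  unitary := fun l hl => by
    rw [Matrix.conjTranspose_mul, hX.unitary l hl, Matrix.mul_inv_rev, inv_of_mem hA]

/-! ### Dressing loops -/

theorem meromorphicAt_const_mul_mul_const {X : ℂ → Mat2} {l : ℂ} (hX : MeromorphicAt X l)
    (A B : Mat2) : MeromorphicAt (fun x => A * X x * B) l := by
  obtain ⟨n, hn⟩ := hX
  refine ⟨n, ?_⟩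
  have h : AnalyticAt ℂ (fun x => A * ((x - l) ^ n • X x) * B) l :=
    (analyticAt_const.mul hn).mul analyticAt_const
  simpa only [Matrix.mul_smul, Matrix.smul_mul] using h

theorem analyticAt_dress {X : ℂ → Mat2} {c : ℂ → ℂ} {l : ℂ} (hX : AnalyticAt ℂ X l)
    (hc : AnalyticAt ℂ c l) (hc0 : c l ≠ 0) (P P' : Mat2) :
    AnalyticAt ℂ (fun x => dress (c x) P P' (X x)) l := by
  have h : ∀ A B : Mat2, AnalyticAt ℂ (fun x => A * X x * B) l := fun A B =>
    (analyticAt_const.mul hX).mul analyticAt_const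
  exact (((h _ _).add (h _ _)).add (hc.smul (h _ _))).add ((hc.inv hc0).smul (h _ _))

theorem tendsto_dress {α : Type*} {f : Filter α} {X : α → Mat2} {c : α → ℂ} {X₀ : Mat2} {c₀ : ℂ}
    (hX : Tendsto X f (𝓝 X₀)) (hc : Tendsto c f (𝓝 c₀)) (hc0 : c₀ ≠ 0) (P P' : Mat2) :
    Tendsto (fun x => dress (c x) P P' (X x)) f (𝓝 (dress c₀ P P' X₀)) := by
  have h : ∀ A B : Mat2, Tendsto (fun x => A * X x * B) f (𝓝 (A * X₀ * B)) := fun A B =>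
    (tendsto_const_nhds.mul hX).mul tendsto_const_nhds
  exact (((h _ _).add (h _ _)).add (hc.smul (h _ _))).add ((hc.inv₀ hc0).smul (h _ _))

theorem meromorphicAt_dress {X : ℂ → Mat2} {c : ℂ → ℂ} {l : ℂ} (hX : MeromorphicAt X l)
    (hc : MeromorphicAt c l) (P P' : Mat2) :
    MeromorphicAt (fun x => dress (c x) P P' (X x)) l := by
  have h := meromorphicAt_const_mul_mul_const hX
  exact (((h _ _).add (h _ _)).add (hc.smul (h _ _))).add (hc.inv.smul (h _ _))

section Dressing

variable {r : ℝ} {l₀ : ℂ} {A A' P P' : Mat2} {X : ℂ → Mat2}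

/-- Dressing a meromorphic unitary loop by simple factors yields a meromorphic unitary loop. -/
theorem IsMeroUnitaryLoop.exists_dress (hX : IsMeroUnitaryLoop r X) (hr : 0 < r)
    (hl₀ : r < ‖l₀‖ ∧ ‖l₀‖ < 1) (hA : A ∈ Matrix.specialUnitaryGroup (Fin 2) ℂ)
    (hA' : A' ∈ Matrix.specialUnitaryGroup (Fin 2) ℂ) (hP : IsLineProj P) (hP' : IsLineProj P') :
    ∃ Y : ℂ → Mat2, IsMeroUnitaryLoop r Y ∧
      (∀ l ∈ sphere (0 : ℂ) r, Y l = A * dress (ratMap l₀ l) P P' (X l) * A') ∧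
      (∀ l ∈ annulus r, l ∉ sing r X → l ≠ l₀ → l ≠ reflect l₀ →
        Y l = A * dress (ratMap l₀ l) P P' (X l) * A') := by
  have h00 : l₀ ≠ 0 := norm_pos_iff.1 (hr.trans hl₀.1)
  set raw : ℂ → Mat2 := fun l => A * dress (ratMap l₀ l) P P' (X l) * A' with hraw
  have hmer : MeromorphicOn raw (annulus r) := fun l hl =>
    meromorphicAt_const_mul_mul_const
      (meromorphicAt_dress (hX.mero hl).meromorphicAt (meromorphicAt_ratMap _ _) _ _) _ _
  -- The pointwise formula may take wrong values at poles and removable singularities. The normal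
  -- form repairs these and leaves the values off the annulus, hence on the circle, unchanged.
  set Y : ℂ → Mat2 := toMeromorphicNFOn raw (annulus r) with hY
  have hNF : MeromorphicNFOn Y (annulus r) := meromorphicNFOn_toMeromorphicNFOn _ _
  have hout : ∀ l ∉ annulus r, Y l = raw l := fun l hl =>
    toMeromorphicNFOn_eq_self_on_compl hmer hl
  have hraw_an : ∀ l, AnalyticAt ℂ X l → l ≠ l₀ → l ≠ reflect l₀ → AnalyticAt ℂ raw l :=
    fun l h1 h2 h3 => (analyticAt_const.mul (analyticAt_dress h1 (analyticAt_ratMap h2)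
      (ratMap_ne_zero h00 hl₀.2 h2 h3) _ _)).mul analyticAt_const
  have heq : ∀ l ∈ annulus r, AnalyticAt ℂ X l → l ≠ l₀ → l ≠ reflect l₀ → Y l = raw l := by
    intro l hl h1 h2 h3
    rw [hY, toMeromorphicNFOn_eq_toMeromorphicNFAt hmer hl,
      toMeromorphicNFAt_eq_self.2 (hraw_an l h1 h2 h3).meromorphicNFAt]
  -- the sphere avoids the poles of the simple factors
  have hsph : ∀ l ∈ sphere (0 : ℂ) r, l ∉ annulus r ∧ l ≠ l₀ ∧ l ≠ reflect l₀ := by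
    intro l hl
    have hl' : ‖l‖ = r := by simpa using hl
    refine ⟨fun h => h.1.ne' hl', ?_, ?_⟩
    · rintro rfl; exact hl₀.1.ne' hl'
    · rintro rfl
      rw [norm_reflect] at hl'
      have : 1 < ‖l₀‖⁻¹ := (one_lt_inv₀ (hr.trans hl₀.1)).2 hl₀.2
      linarith
  have hdet_raw : ∀ l, (X l).det = 1 → l ≠ l₀ → l ≠ reflect l₀ → (raw l).det = 1 := by
    intro l h1 h2 h3
    rw [hraw]
    simp only [Matrix.det_mul]
    rw [det_of_mem hA, det_of_mem hA', det_dress (ratMap_ne_zero h00 hl₀.2 h2 h3) hP hP', h1,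
      one_mul, mul_one]
  have hev : ∀ l ∈ annulus r, ∀ᶠ m in 𝓝[≠] l, m ∈ annulus r ∧ m ∉ sing r X ∧ m ≠ l₀ ∧
      m ≠ reflect l₀ := by
    intro l hl
    have hne : ∀ a : ℂ, ∀ᶠ m in 𝓝[≠] l, m ≠ a := by
      intro a
      rcases eq_or_ne l a with rfl | h
      · exact self_mem_nhdsWithin
      · exact nhdsWithin_le_nhds (isOpen_ne.mem_nhds h)
    filter_upwards [eventually_notMem_sing hX.mero hl, hne l₀, hne (reflect l₀)] with m h1 h2 h3
    exact ⟨h1.1, h1.2, h2, h3⟩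
  -- The formula may fail at `l` itself, but it holds at all nearby points, and the determinant
  -- passes to the limit.
  have hdetY : ∀ l ∈ annulus r \ sing r Y, (Y l).det = 1 := by
    intro l hl
    have hc := (analyticAt_of_notMem_sing hNF hl.1 hl.2).continuousAt
    have h1 : Tendsto (fun m => (Y m).det) (𝓝[≠] l) (𝓝 (Y l).det) :=
      ((continuous_id.matrix_det.tendsto (Y l)).comp hc.tendsto).mono_left nhdsWithin_le_nhds
    refine tendsto_nhds_unique h1 (tendsto_const_nhds.congr' ?_)
    filter_upwards [hev l hl.1] with m hm
    rw [heq m hm.1 (analyticAt_of_notMem_sing hX.mero hm.1 hm.2.1) hm.2.2.1 hm.2.2.2,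
      hdet_raw m (hX.det_eq m ⟨hm.1, hm.2.1⟩) hm.2.2.1 hm.2.2.2]
  refine ⟨Y, ⟨⟨?_, ?_⟩, hNF, ?_, hdetY, ?_⟩, fun l hl => hout l (hsph l hl).1,
    fun l hl h1 h2 h3 => heq l hl (analyticAt_of_notMem_sing hX.mero hl h1) h2 h3⟩
  · intro l hl
    rw [hout l (hsph l hl).1]
    exact hdet_raw l (hX.loop.1 l hl) (hsph l hl).2.1 (hsph l hl).2.2
  · obtain ⟨Z, hZ, hXZ⟩ := hX.loop.2
    refine ⟨fun l => A * dress (ratMap l₀ l) P P' (Z l) * A', fun l hl => ?_, fun l hl => ?_⟩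
    · exact (analyticAt_const.mul (analyticAt_dress (hZ l hl) (analyticAt_ratMap (hsph l hl).2.1)
        (ratMap_ne_zero h00 hl₀.2 (hsph l hl).2.1 (hsph l hl).2.2) _ _)).mul analyticAt_const
    · rw [hout l (hsph l hl).1, hraw]
      simp only [hXZ hl]
  · intro l hl
    obtain ⟨h1, h2, h3⟩ := hsph l hl
    -- Near `l` the loop stays nonzero, whereas normal form gives `0` at poles; so no poles
    -- accumulate at the circle.
    have hX0 : X l ≠ 0 := by
      intro h
      have := hX.loop.1 l hl
      rw [h] at this
      simp at this
    have ht : Tendsto raw (𝓝[annulus r] l) (𝓝 (raw l)) :=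
      (tendsto_const_nhds.mul (tendsto_dress (hX.boundary l hl)
        ((analyticAt_ratMap h2).continuousAt.tendsto.mono_left nhdsWithin_le_nhds)
        (ratMap_ne_zero h00 hl₀.2 h2 h3) _ _)).mul tendsto_const_nhds
    rw [hout l h1]
    refine ht.congr' ?_
    filter_upwards [(hX.boundary l hl).eventually (isOpen_ne.mem_nhds hX0), self_mem_nhdsWithin,
      nhdsWithin_le_nhds (isOpen_ne.mem_nhds h2), nhdsWithin_le_nhds (isOpen_ne.mem_nhds h3)]
      with m hm hm' hm2 hm3
    refine (heq m hm' ?_ hm2 hm3).symm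
    rcases meromorphicNFAt_iff_analyticAt_or.1 (hX.mero hm') with h | ⟨_, _, h⟩
    · exact h
    · exact absurd h hm
  · intro l hl
    have hl0 : l ≠ 0 := ne_zero_of_mem_annulus hr hl.1
    have hm := reflect_mem_annulus hr hl.1
    -- Unitarity is checked near the mirror point. Its limit there exists because `Y` is continuous
    -- at `l`, so the mirror point is no pole and continuity gives the identity.
    have hpt : ∀ᶠ w in 𝓝[≠] (reflect l), (Y (reflect w)).adjugateᴴ = Y w := by
      filter_upwards [hev _ hm, (tendsto_reflect_nhdsNE hl0).eventually (hev l hl.1)]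
        with w hw hv
      have hv0 : reflect w ≠ 0 := ne_zero_of_mem_annulus hr hv.1
      have hXv := hX.det_eq _ ⟨hv.1, hv.2.1⟩
      have hu := hX.unitary _ ⟨hv.1, hv.2.1⟩
      have hdv := hdet_raw _ hXv hv.2.2.1 hv.2.2.2
      have hc := ratMap_ne_zero h00 hl₀.2 hv.2.2.1 hv.2.2.2
      have hcr := ratMap_reflect l₀ hv0
      rw [reflect_reflect] at hu hcr
      rw [heq _ hw.1 (analyticAt_of_notMem_sing hX.mero hw.1 hw.2.1) hw.2.2.1 hw.2.2.2,
        heq _ hv.1 (analyticAt_of_notMem_sing hX.mero hv.1 hv.2.1) hv.2.2.1 hv.2.2.2,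
        ← inv_eq_adjugate hdv]
      rw [← Matrix.conjTranspose_conjTranspose (raw w)]
      congr 1
      simp only [hraw, Matrix.conjTranspose_mul, Matrix.mul_inv_rev]
      rw [inv_of_mem hA, inv_of_mem hA', conjTranspose_dress hP hP', hcr, hu,
        dress_inv hc hP hP' hXv]
    have hYl := (analyticAt_of_notMem_sing hNF hl.1 hl.2).continuousAt
    have hadj : Continuous fun M : Mat2 => M.adjugateᴴ :=
      continuous_id.matrix_adjugate.matrix_conjTranspose
    have hlim : Tendsto Y (𝓝[≠] (reflect l)) (𝓝 (Y l).adjugateᴴ) := by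
      refine Tendsto.congr' hpt ?_
      exact (hadj.tendsto _).comp (hYl.tendsto.comp
        ((tendsto_reflect_nhdsNE hl0).mono_right nhdsWithin_le_nhds))
    have hord := (tendsto_nhds_iff_meromorphicOrderAt_nonneg (hNF hm).meromorphicAt).1 ⟨_, hlim⟩
    have hc := ((hNF hm).meromorphicOrderAt_nonneg_iff_analyticAt.1 hord).continuousAt
    rw [tendsto_nhds_unique (hc.tendsto.mono_left nhdsWithin_le_nhds) hlim,
      Matrix.conjTranspose_conjTranspose, inv_eq_adjugate (hdetY l hl)]

/-- Dressing a unitary loop by simple factors with compatible lines yields a unitary loop. -/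
theorem IsUnitaryLoop.exists_dress (hX : IsUnitaryLoop r X) (hr : 0 < r) (hr₁ : r < 1)
    (hl₀ : r < ‖l₀‖ ∧ ‖l₀‖ < 1) (hA' : A' ∈ Matrix.specialUnitaryGroup (Fin 2) ℂ)
    (hP : IsLineProj P) (hP' : IsLineProj P') (h : P * X l₀ * (1 - P') = 0) :
    ∃ Y : ℂ → Mat2, IsUnitaryLoop r Y ∧
      (∀ l ∈ sphere (0 : ℂ) r, Y l = dress (ratMap l₀ l) P P' (X l) * A') ∧
      (∀ l ∈ annulus r, l ≠ l₀ → l ≠ reflect l₀ → Y l = dress (ratMap l₀ l) P P' (X l) * A') ∧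
      (1 - P) * Y l₀ * (A'ᴴ * P') = 0 := by
  have h00 : l₀ ≠ 0 := norm_pos_iff.1 (hr.trans hl₀.1)
  have hl₀r : l₀ ≠ reflect l₀ := by
    intro hh
    have h1 := norm_reflect l₀
    rw [← hh] at h1
    have : 1 < ‖l₀‖⁻¹ := (one_lt_inv₀ (hr.trans hl₀.1)).2 hl₀.2
    linarith [hl₀.2]
  have hl₀a : l₀ ∈ annulus r := ⟨hl₀.1, hl₀.2.trans ((one_lt_div hr).2 hr₁)⟩
  obtain ⟨Y, hY, hs, ha⟩ := hX.isMeroUnitaryLoop.exists_dress hr hl₀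
    (one_mem (Matrix.specialUnitaryGroup (Fin 2) ℂ)) hA' hP hP'
  have hsing := sing_eq_empty hX.holo
  replace ha : ∀ l ∈ annulus r, l ≠ l₀ → l ≠ reflect l₀ →
      Y l = dress (ratMap l₀ l) P P' (X l) * A' := fun l hl h1 h2 => by
    rw [ha l hl (by simp [hsing]) h1 h2, one_mul]
  have hXan : ∀ l ∈ annulus r, AnalyticAt ℂ X l := fun l hl =>
    hX.holo.analyticAt ((isOpen_annulus r).mem_nhds hl)
  have hev : ∀ᶠ l in 𝓝[≠] l₀, Y l = dress (ratMap l₀ l) P P' (X l) * A' := by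
    filter_upwards [self_mem_nhdsWithin, nhdsWithin_le_nhds ((isOpen_annulus r).mem_nhds hl₀a),
      nhdsWithin_le_nhds (isOpen_ne.mem_nhds hl₀r)] with l h1 h2 h3
    exact ha l h2 h1 h3
  -- The pole of `f` is a zero of `f⁻¹`; this kills one of the four blocks of `dress` at `l₀`.
  have hinv : Tendsto (fun l => (ratMap l₀ l)⁻¹) (𝓝[≠] l₀) (𝓝 0) := by
    have := (analyticAt_ratMap_inv h00 hl₀r).continuousAt.tendsto
    simp only [ratMap_inv l₀ l₀, sub_self, zero_div, mul_zero] at this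
    exact this.mono_left nhdsWithin_le_nhds
  have hXt : Tendsto X (𝓝[≠] l₀) (𝓝 (X l₀)) :=
    (hXan l₀ hl₀a).continuousAt.tendsto.mono_left nhdsWithin_le_nhds
  have hXmul : ∀ B B' : Mat2, Tendsto (fun l => B * X l * B') (𝓝[≠] l₀) (𝓝 (B * X l₀ * B')) :=
    fun B B' => (tendsto_const_nhds.mul hXt).mul tendsto_const_nhds
  have hl₀s : l₀ ∉ sing r Y := by
    -- the simple pole of `ratMap` is cancelled by the zero of `P * X * (1 - P')`
    have hslope : ∃ D, Tendsto (fun l => ratMap l₀ l • (P * X l * (1 - P'))) (𝓝[≠] l₀) (𝓝 D) := by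
      set Z : ℂ → Mat2 := fun l => P * X l * (1 - P') with hZ
      have hZd : DifferentiableAt ℂ Z l₀ :=
        ((analyticAt_const.mul (hXan l₀ hl₀a)).mul analyticAt_const).differentiableAt
      have h1 := hasDerivAt_iff_tendsto_slope.1 hZd.hasDerivAt
      have h2 : Tendsto (fun l => (1 - l₀) / (1 - conj l₀) * (1 - conj l₀ * l)) (𝓝[≠] l₀)
          (𝓝 ((1 - l₀) / (1 - conj l₀) * (1 - conj l₀ * l₀))) :=
        (Continuous.tendsto (by fun_prop) l₀).mono_left nhdsWithin_le_nhds
      refine ⟨_, (h2.smul h1).congr fun l => ?_⟩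
      have hZ0 : Z l₀ = 0 := h
      rw [slope_def_module, hZ0, sub_zero, smul_smul, ratMap]
      congr 1
      ring
    obtain ⟨D, hD⟩ := hslope
    have ht : Tendsto Y (𝓝[≠] l₀) (𝓝 ((P * X l₀ * P' + (1 - P) * X l₀ * (1 - P') + D +
        (0 : ℂ) • ((1 - P) * X l₀ * P')) * A')) := by
      refine Tendsto.congr' (hev.mono fun _ hl => hl.symm) ?_
      exact ((((hXmul _ _).add (hXmul _ _)).add hD).add
        (hinv.smul (hXmul _ _))).mul tendsto_const_nhds
    intro hmem
    exact not_lt.2 ((tendsto_nhds_iff_meromorphicOrderAt_nonneg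
      (hY.mero hl₀a).meromorphicAt).1 ⟨_, ht⟩) hmem.2
  have hsY : sing r Y = ∅ := by
    ext l
    simp only [Set.mem_empty_iff_false, iff_false]
    intro hl
    rcases eq_or_ne l l₀ with rfl | h1
    · exact hl₀s hl
    rcases eq_or_ne l (reflect l₀) with rfl | h2
    -- No computation is needed at the mirror point: regularity is inherited from `l₀` through
    -- unitarity.
    · exact hY.reflect_notMem_sing ⟨hl₀a, hl₀s⟩ hl
    have han : AnalyticAt ℂ (fun l => dress (ratMap l₀ l) P P' (X l) * A') l :=
      (analyticAt_dress (hXan l hl.1) (analyticAt_ratMap h1)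
        (ratMap_ne_zero h00 hl₀.2 h1 h2) _ _).mul analyticAt_const
    have hYan : AnalyticAt ℂ Y l := by
      refine han.congr ?_
      filter_upwards [(isOpen_annulus r).mem_nhds hl.1, isOpen_ne.mem_nhds h1,
        isOpen_ne.mem_nhds h2] with m h3 h4 h5
      exact (ha m h3 h4 h5).symm
    exact not_lt.2 hYan.meromorphicOrderAt_nonneg hl.2
  have hYu := hY.isUnitaryLoop hsY
  refine ⟨Y, hYu, fun l hl => by rw [hs l hl, one_mul], ha, ?_⟩
  have hYt : Tendsto Y (𝓝[≠] l₀) (𝓝 (Y l₀)) :=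
    (hYu.holo.analyticAt ((isOpen_annulus r).mem_nhds hl₀a)).continuousAt.tendsto.mono_left
      nhdsWithin_le_nhds
  -- The outer projections retain only the block with coefficient `f⁻¹`, which vanishes at `l₀`.
  have h1 : Tendsto (fun l => (1 - P) * Y l * (A'ᴴ * P')) (𝓝[≠] l₀)
      (𝓝 ((1 - P) * Y l₀ * (A'ᴴ * P'))) := (tendsto_const_nhds.mul hYt).mul tendsto_const_nhds
  have h2 : Tendsto (fun l => (ratMap l₀ l)⁻¹ • ((1 - P) * X l * P')) (𝓝[≠] l₀)
      (𝓝 ((0 : ℂ) • ((1 - P) * X l₀ * P'))) := hinv.smul (hXmul _ _)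
  rw [zero_smul] at h2
  refine tendsto_nhds_unique h1 (h2.congr' ?_)
  filter_upwards [hev] with l hl
  rw [hl]
  calc _ = (ratMap l₀ l)⁻¹ • ((1 - P) * X l * P') := rfl
    _ = (1 - P) * dress (ratMap l₀ l) P P' (X l) * P' := by
        simp only [dress, mul_add, add_mul, Matrix.mul_smul, Matrix.smul_mul, ← mul_assoc,
          hP.compl_mul, hP.compl.mul_self, zero_mul, smul_zero, zero_add]
        simp only [mul_assoc, hP'.mul_self, hP'.compl_mul, mul_zero, zero_add, add_zero]
    _ = (1 - P) * dress (ratMap l₀ l) P P' (X l) * (A' * A'ᴴ) * P' := by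
        rw [mul_conjTranspose_of_mem hA', mul_one]
    _ = _ := by simp only [mul_assoc]

end Dressing

/-! ### Lines and their projections -/

/-- If the trace were not `1`, Cayley–Hamilton would make `P` a scalar, hence `0` or `1`. -/
theorem trace_eq_one_of_idempotent {P : Mat2} (hP : P * P = P) (h0 : P ≠ 0) (h1 : P ≠ 1) :
    P.trace = 1 := by
  by_contra ht
  have ht' : P.trace - 1 ≠ 0 := sub_ne_zero.2 ht
  have h := mul_self_eq_trace_smul_sub P
  rw [hP] at h
  have h2 : (P.trace - 1) • P = P.det • (1 : Mat2) := by
    rw [sub_smul, one_smul, sub_eq_iff_eq_add]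
    exact (sub_eq_iff_eq_add'.1 h.symm)
  have h3 : P = ((P.trace - 1)⁻¹ * P.det) • (1 : Mat2) := by
    rw [← smul_smul, ← h2, smul_smul, inv_mul_cancel₀ ht', one_smul]
  generalize (P.trace - 1)⁻¹ * P.det = z at h3
  rw [h3] at hP
  have h4 : z * z = z := by simpa using congrFun (congrFun hP 0) 0
  rcases IsIdempotentElem.iff_eq_zero_or_one.1 h4 with rfl | rfl
  · exact h0 (by rw [h3, zero_smul])
  · exact h1 (by rw [h3, one_smul])

theorem projMatrix_orthogonal (K : Submodule ℂ (EuclideanSpace ℂ (Fin 2))) :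
    projMatrix Kᗮ = 1 - projMatrix K := by
  rw [projMatrix, projMatrix, Submodule.starProjection_orthogonal', map_sub, map_one]

theorem toEuclideanCLM_projMatrix (K : Submodule ℂ (EuclideanSpace ℂ (Fin 2))) :
    Matrix.toEuclideanCLM (n := Fin 2) (𝕜 := ℂ) (projMatrix K) = K.starProjection := by
  rw [projMatrix, StarAlgEquiv.apply_symm_apply]

theorem isLineProj_projMatrix (L : CP1) : IsLineProj (projMatrix L.submodule) := by
  have hstar := isStarProjection_starProjection (U := L.submodule)
  have hmul : projMatrix L.submodule * projMatrix L.submodule = projMatrix L.submodule := by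
    rw [projMatrix, ← map_mul, hstar.1.eq]
  refine ⟨?_, hmul, trace_eq_one_of_idempotent hmul ?_ ?_⟩
  · rw [← Matrix.star_eq_conjTranspose, projMatrix]
    exact ((Matrix.toEuclideanCLM (n := Fin 2) (𝕜 := ℂ)).symm.map_star' _).symm.trans
      (congrArg _ hstar.2.star_eq)
  · intro h
    have h1 := toEuclideanCLM_projMatrix L.submodule
    rw [h, map_zero] at h1
    have h2 : L.submodule = ⊥ := by
      rw [eq_bot_iff]
      intro v hv
      rw [← Submodule.starProjection_eq_self_iff.2 hv, ← h1]
      simp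
    have h3 := L.finrank_submodule
    rw [h2, finrank_bot] at h3
    exact zero_ne_one h3
  · intro h
    have h1 := toEuclideanCLM_projMatrix L.submodule
    rw [h, map_one] at h1
    have h2 : L.submodule = ⊤ := by
      rw [eq_top_iff]
      intro v _
      rw [← Submodule.starProjection_eq_self_iff, ← h1]
      rfl
    have h3 := L.finrank_submodule
    rw [h2, finrank_top, finrank_euclideanSpace_fin] at h3
    norm_num at h3

/-- `Aᴴ` carries `L₁` into `L₂`, so it is killed between the projections onto `L₁` and `L₂ᗮ`; the
claim is the adjoint of this. -/
theorem projMatrix_mul_eq_zero {A : Mat2} {L₁ L₂ : CP1}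
    (hL : L₂.submodule = L₁.submodule.map (Matrix.toEuclideanLin Aᴴ)) :
    projMatrix L₁.submodule * A * (1 - projMatrix L₂.submodule) = 0 := by
  have h : (1 - projMatrix L₂.submodule) * Aᴴ * projMatrix L₁.submodule = 0 := by
    rw [← projMatrix_orthogonal]
    refine (Matrix.toEuclideanCLM (n := Fin 2) (𝕜 := ℂ)).injective ?_
    change Matrix.toEuclideanCLM (n := Fin 2) (𝕜 := ℂ) _ = Matrix.toEuclideanCLM (n := Fin 2) (𝕜 := ℂ) 0
    rw [map_mul, map_mul, map_zero, toEuclideanCLM_projMatrix, toEuclideanCLM_projMatrix]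
    ext1 v
    have hv : Matrix.toEuclideanCLM (n := Fin 2) (𝕜 := ℂ) Aᴴ (L₁.submodule.starProjection v)
        ∈ L₂.submodule := by
      rw [hL]
      exact Submodule.mem_map_of_mem (Submodule.starProjection_apply_mem _ v)
    change L₂.submoduleᗮ.starProjection (Matrix.toEuclideanCLM (n := Fin 2) (𝕜 := ℂ) Aᴴ
      (L₁.submodule.starProjection v)) = 0
    rw [Submodule.starProjection_orthogonal']
    simp [Submodule.starProjection_eq_self_iff.2 hv]
  have h2 := congrArg Matrix.conjTranspose h
  rwa [Matrix.conjTranspose_mul, Matrix.conjTranspose_mul, Matrix.conjTranspose_conjTranspose,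
    Matrix.conjTranspose_zero, (isLineProj_projMatrix L₁).conjTranspose_eq,
    (isLineProj_projMatrix L₂).compl.conjTranspose_eq, ← mul_assoc] at h2

/-- All constant unitary factors merge into one. The triangular normalization can be dropped, since
undressing works for any unitary constant on the left. -/
theorem IsGeneralSimpleFactor.exists_eq {r : ℝ} {W : Mat2} {l₀ : ℂ} {L : CP1} {g : ℂ → Mat2}
    (hg : IsGeneralSimpleFactor r W l₀ L g) :
    ∃ s : ℂ → ℂ, AnalyticOnNhd ℂ s (closedBall 0 r) ∧
      (∀ l ∈ closedBall (0 : ℂ) r, s l ^ 2 = ratMap l₀ l) ∧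
      ∃ A ∈ Matrix.specialUnitaryGroup (Fin 2) ℂ, ∀ l ∈ closedBall (0 : ℂ) r,
        g l = A * simpleFactor (s l) (projMatrix L.submodule) := by
  obtain ⟨hW, ψ, ⟨h, ⟨s, hs, hsq, hh⟩, Q, hQ, -, hψ⟩, hg⟩ := hg
  refine ⟨s, hs, hsq, W * Qᴴ, mul_mem hW (conjTranspose_mem hQ), fun l hl => ?_⟩
  rw [hg l hl, hψ l hl, hh l hl, inv_of_mem hQ, projMatrix_orthogonal, mul_assoc]
  rfl

/-! ### Undressing Iwasawa factorizations -/

section Undress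

theorem dress_inv_dress {c : ℂ} {P P' X : Mat2} (hc : c ≠ 0) (hP : IsLineProj P)
    (hP' : IsLineProj P') : dress c⁻¹ P P' (dress c P P' X) = X := by
  obtain ⟨s, hs, rfl⟩ := exists_sq_eq hc
  rw [← inv_pow, dress_sq (inv_ne_zero hs), dress_sq hs, inv_inv]
  calc _ = simpleFactor s⁻¹ P * simpleFactor s P * X * (simpleFactor s⁻¹ P' * simpleFactor s P') :=
        by simp only [mul_assoc]
    _ = X := by rw [simpleFactor_inv_mul hs hP, simpleFactor_inv_mul hs hP', one_mul, mul_one]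

theorem dress_unitaryConj {c : ℂ} {P P' X K K' : Mat2} (hc : c ≠ 0)
    (hK : K ∈ Matrix.specialUnitaryGroup (Fin 2) ℂ)
    (hK' : K' ∈ Matrix.specialUnitaryGroup (Fin 2) ℂ) :
    dress c P P' (K * X * K'ᴴ) = K * dress c (Kᴴ * P * K) (K'ᴴ * P' * K') X * K'ᴴ := by
  obtain ⟨s, hs, rfl⟩ := exists_sq_eq hc
  rw [dress_sq hs, dress_sq hs]
  have h1 : simpleFactor s P * K = K * simpleFactor s (Kᴴ * P * K) := by
    calc _ = K * (Kᴴ * simpleFactor s P) * K := by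
          rw [← mul_assoc, mul_conjTranspose_of_mem hK, one_mul]
      _ = K * simpleFactor s (Kᴴ * P * K) * (Kᴴ * K) := by
          rw [simpleFactor_conj hK]; simp only [mul_assoc]
      _ = _ := by rw [conjTranspose_mul_of_mem hK, mul_one]
  calc _ = simpleFactor s P * K * X * (K'ᴴ * simpleFactor s⁻¹ P') := by simp only [mul_assoc]
    _ = _ := by rw [h1, simpleFactor_conj hK']; simp only [mul_assoc]

variable {r : ℝ} {l₀ : ℂ} {s : ℂ → ℂ} {A P : Mat2} {g Φ G C : ℂ → Mat2}

theorem ne_of_mem_closedBall (hr : 0 < r) (hl₀ : r < ‖l₀‖ ∧ ‖l₀‖ < 1) {l : ℂ}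
    (hl : l ∈ closedBall (0 : ℂ) r) : l ≠ l₀ ∧ l ≠ reflect l₀ := by
  have hl' : ‖l‖ ≤ r := by simpa using hl
  have h1 : 1 < ‖l₀‖⁻¹ := (one_lt_inv₀ (hr.trans hl₀.1)).2 hl₀.2
  constructor
  · rintro rfl; linarith [hl₀.1]
  · rintro rfl
    rw [norm_reflect] at hl'
    linarith [hl₀.1, hl₀.2]

theorem ratMap_ne_zero_of_mem_closedBall (hr : 0 < r) (hl₀ : r < ‖l₀‖ ∧ ‖l₀‖ < 1) {l : ℂ}
    (hl : l ∈ closedBall (0 : ℂ) r) : ratMap l₀ l ≠ 0 :=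
  ratMap_ne_zero (norm_pos_iff.1 (hr.trans hl₀.1)) hl₀.2 (ne_of_mem_closedBall hr hl₀ hl).1
    (ne_of_mem_closedBall hr hl₀ hl).2

/-- Multiplying a positive loop by a normalized simple factor yields a positive loop. -/
theorem IsPositiveLoop.simpleFactor_mul (hC : IsPositiveLoop r C)
    (hs : AnalyticOnNhd ℂ s (closedBall 0 r)) (hs0 : ∀ l ∈ closedBall (0 : ℂ) r, s l ≠ 0)
    {R K : Mat2} (hR : IsLineProj R) (hK : K ∈ Matrix.specialUnitaryGroup (Fin 2) ℂ)
    (hT : PosTriangular (Kᴴ * simpleFactor (s 0) R)) :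
    IsPositiveLoop r (fun l => Kᴴ * simpleFactor (s l) R * C l) := by
  have hsub : sphere (0 : ℂ) r ⊆ closedBall 0 r := sphere_subset_closedBall
  have han : ∀ l ∈ closedBall (0 : ℂ) r,
      AnalyticAt ℂ (fun l => Kᴴ * simpleFactor (s l) R) l := fun l hl =>
    analyticAt_const.mul (((hs l hl).smul analyticAt_const).add
      (((hs l hl).inv (hs0 l hl)).smul analyticAt_const))
  have hdet : ∀ l ∈ closedBall (0 : ℂ) r, (C l).det = 1 →
      (Kᴴ * simpleFactor (s l) R * C l).det = 1 := fun l hl h => by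
    rw [Matrix.det_mul, Matrix.det_mul, det_of_mem (conjTranspose_mem hK),
      det_simpleFactor (hs0 l hl) hR, h, one_mul, one_mul]
  refine ⟨⟨fun l hl => hdet l (hsub hl) (hC.loop.1 l hl), ?_⟩, ?_, ?_, ?_, hT.mul hC.normalized⟩
  · obtain ⟨Z, hZ, hCZ⟩ := hC.loop.2
    refine ⟨fun l => Kᴴ * simpleFactor (s l) R * Z l, fun l hl => (han l (hsub hl)).mul (hZ l hl),
      fun l hl => ?_⟩
    simp only [hCZ hl]
  · exact fun l hl => (han l (ball_subset_closedBall hl)).differentiableAt.differentiableWithinAt.mul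
      (hC.holo l hl)
  · exact fun l hl => ((han l (hsub hl)).continuousAt.tendsto.mono_left nhdsWithin_le_nhds).mul
      (hC.boundary l hl)
  · exact fun l hl => hdet l (ball_subset_closedBall hl) (hC.det_eq l hl)

/-- The Iwasawa factorization of `Φ` in terms of that of `g Φ`, for a simple factor `g`. -/
theorem IsIwasawa.exists_undress (hI : IsIwasawa r (fun l => g l * Φ l) G C) (hr : 0 < r)
    (hr₁ : r < 1) (hl₀ : r < ‖l₀‖ ∧ ‖l₀‖ < 1) (hA : A ∈ Matrix.specialUnitaryGroup (Fin 2) ℂ)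
    (hP : IsLineProj P) (hs : AnalyticOnNhd ℂ s (closedBall 0 r))
    (hsq : ∀ l ∈ closedBall (0 : ℂ) r, s l ^ 2 = ratMap l₀ l)
    (hg : ∀ l ∈ closedBall (0 : ℂ) r, g l = A * simpleFactor (s l) P) :
    ∃ (F B : ℂ → Mat2) (R K : Mat2), IsIwasawa r Φ F B ∧ IsLineProj R ∧
      K ∈ Matrix.specialUnitaryGroup (Fin 2) ℂ ∧ PosTriangular (Kᴴ * simpleFactor (s 0) R) ∧
      (∀ l ∈ annulus r, l ≠ l₀ → l ≠ reflect l₀ →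
        F l = dress (ratMap l₀ l) (1 - P) R (Aᴴ * G l) * K) ∧
      (∀ l ∈ ball (0 : ℂ) r, B l = Kᴴ * simpleFactor (s l) R * C l) ∧
      P * F l₀ * (Kᴴ * R) = 0 := by
  have hl₀a : l₀ ∈ annulus r := ⟨hl₀.1, hl₀.2.trans ((one_lt_div hr).2 hr₁)⟩
  have hs0 : ∀ l ∈ closedBall (0 : ℂ) r, s l ≠ 0 := fun l hl h =>
    ratMap_ne_zero_of_mem_closedBall hr hl₀ hl (by rw [← hsq l hl, h]; ring)
  have hF' := hI.unitary.const_mul (conjTranspose_mem hA)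
  -- `R` is chosen to cancel the pole of the undressed frame at `l₀`; `K` below then restores the
  -- normalization of the positive factor at `0`.
  obtain ⟨R, hR, hPR⟩ := hP.compl.exists_pullback (hF'.det_eq l₀ hl₀a)
  obtain ⟨K, hK, hT⟩ := exists_qr (det_simpleFactor (hs0 0 (by simpa using hr.le)) hR)
  rw [inv_of_mem hK] at hT
  obtain ⟨F, hF, hFs, hFa, hF0⟩ := hF'.exists_dress hr hr₁ hl₀ hK hP.compl hR hPR
  rw [sub_sub_cancel] at hF0
  refine ⟨F, fun l => Kᴴ * simpleFactor (s l) R * C l, R, K,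
    ⟨hF, hI.positive.simpleFactor_mul hs hs0 hR hK hT, fun l hl => ?_⟩, hR, hK, hT, hFa,
    fun _ _ => rfl, hF0⟩
  have hlc := sphere_subset_closedBall hl
  have hm := hI.mul_eq l hl
  simp only [hg l hlc] at hm
  rw [hFs l hl, ← hsq l hlc, dress_sq (hs0 l hlc), simpleFactor_compl]
  symm
  calc _ = simpleFactor (s l)⁻¹ P * Aᴴ * G l * (simpleFactor (s l)⁻¹ R * ((K * Kᴴ) *
          simpleFactor (s l) R)) * C l := by simp only [mul_assoc]
    _ = simpleFactor (s l)⁻¹ P * Aᴴ * (G l * C l) := by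
        rw [mul_conjTranspose_of_mem hK, one_mul, simpleFactor_inv_mul (hs0 l hlc) hR, mul_one,
          mul_assoc _ (G l)]
    _ = simpleFactor (s l)⁻¹ P * ((Aᴴ * A) * simpleFactor (s l) P) * Φ l := by
        rw [← hm]; simp only [mul_assoc]
    _ = Φ l := by
        rw [conjTranspose_mul_of_mem hA, one_mul, simpleFactor_inv_mul (hs0 l hlc) hP, one_mul]

end Undress

/-! ### Convergence of the dressed factors -/

/-- Convergence is assumed only on regions, so evaluating it at `l₀` requires a small disc that
stays away from the poles. -/
theorem exists_region_of_notMem_sing {r : ℝ} {U : ℂ → Mat2} {l₀ : ℂ}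
    (hU : MeromorphicNFOn U (annulus r)) (hl : l₀ ∈ annulus r) (hs : l₀ ∉ sing r U) :
    ∃ R, IsRegionAwayFrom r (sing r U) R ∧ l₀ ∈ R := by
  have h1 := (analyticAt_of_notMem_sing hU hl hs).eventually_analyticAt
  obtain ⟨ε, hε, hb⟩ := Metric.eventually_nhds_iff_ball.1
    (h1.and ((isOpen_annulus r).mem_nhds hl))
  refine ⟨ball l₀ (ε / 2), ⟨isOpen_ball,
    ⟨⟨l₀, mem_ball_self (half_pos hε)⟩, (convex_ball _ _).isPreconnected⟩,
    fun l h => (hb l (ball_subset_ball (half_le_self hε.le) h)).2,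
    ε / 2, half_pos hε, fun l h t ht => ?_⟩, mem_ball_self (half_pos hε)⟩
  by_contra! hlt
  have htb : t ∈ ball l₀ ε := by
    have := dist_triangle_left t l₀ l
    rw [mem_ball] at h ⊢
    linarith
  exact not_lt.2 (hb t htb).1.meromorphicOrderAt_nonneg ht.2

/-- Two general simple factors with the same singularity can be written with the same branch of
the square root. -/
theorem exists_common_branch {r : ℝ} (hr : 0 < r) {W : Mat2} {l₀ : ℂ}
    (hl₀ : r < ‖l₀‖ ∧ ‖l₀‖ < 1) {L₁ L₂ : CP1} {g₁ g₂ : ℂ → Mat2}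
    (hg₁ : IsGeneralSimpleFactor r W l₀ L₁ g₁) (hg₂ : IsGeneralSimpleFactor r W l₀ L₂ g₂) :
    ∃ s : ℂ → ℂ, AnalyticOnNhd ℂ s (closedBall 0 r) ∧
      (∀ l ∈ closedBall (0 : ℂ) r, s l ^ 2 = ratMap l₀ l) ∧
      ∃ A₁ ∈ Matrix.specialUnitaryGroup (Fin 2) ℂ, ∃ A₂ ∈ Matrix.specialUnitaryGroup (Fin 2) ℂ,
        (∀ l ∈ closedBall (0 : ℂ) r, g₁ l = A₁ * simpleFactor (s l) (projMatrix L₁.submodule)) ∧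
        ∀ l ∈ closedBall (0 : ℂ) r, g₂ l = A₂ * simpleFactor (s l) (projMatrix L₂.submodule) := by
  obtain ⟨s, hs, hsq, A₁, hA₁, h₁⟩ := hg₁.exists_eq
  obtain ⟨t, ht, htq, A₂, hA₂, h₂⟩ := hg₂.exists_eq
  -- Two continuous roots of a nonvanishing function on a connected disc agree up to one sign, which
  -- is absorbed into `A₂`.
  have hor := (convex_closedBall (0 : ℂ) r).isPreconnected.eq_or_eq_neg_of_sq_eq ht.continuousOn
    hs.continuousOn (fun l hl => by simp [hsq l hl, htq l hl]) (fun {l} hl h =>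
      ratMap_ne_zero_of_mem_closedBall hr hl₀ hl (by rw [← hsq l hl, h]; ring))
  refine ⟨s, hs, hsq, A₁, hA₁, ?_⟩
  rcases hor with h | h
  · exact ⟨A₂, hA₂, h₁, fun l hl => by rw [h₂ l hl, h hl]⟩
  · refine ⟨-A₂, neg_mem_specialUnitaryGroup hA₂, h₁, fun l hl => ?_⟩
    rw [h₂ l hl, h hl, Pi.neg_apply, simpleFactor_neg, mul_neg, neg_mul]

/-- The relation between the lines of two undressed frames. -/
theorem compl_mul_mul_eq_zero {P₁ P₂ T₁ T₂ F₁ F₂ U : Mat2} (hP₁ : IsLineProj P₁)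
    (hT₁ : IsLineProj T₁) (hF₁ : F₁.det = 1) (h₁ : P₁ * F₁ * T₁ = 0) (h₂ : P₂ * F₂ * T₂ = 0)
    (hU : P₁ * U * (1 - P₂) = 0) : (1 - T₁) * (F₁⁻¹ * U * F₂) * T₂ = 0 := by
  have h3 : (1 - T₁) * F₁⁻¹ * (1 - P₁) = 0 := by
    have := congrArg Matrix.adjugate h₁
    rwa [Matrix.adjugate_mul_distrib, Matrix.adjugate_mul_distrib, hT₁.adjugate_eq,
      hP₁.adjugate_eq, ← inv_eq_adjugate hF₁, Matrix.adjugate_zero, ← mul_assoc] at this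
  -- Insert `1 = P₁ + (1 - P₁)` before `U` and `1 = P₂ + (1 - P₂)` after it; each surviving term
  -- contains a vanishing factor.
  calc _ = (1 - T₁) * F₁⁻¹ * (1 - P₁) * (U * F₂ * T₂) +
        (1 - T₁) * F₁⁻¹ * (P₁ * U * (1 - P₂)) * (F₂ * T₂) +
        (1 - T₁) * F₁⁻¹ * P₁ * U * (P₂ * F₂ * T₂) := by noncomm_ring
    _ = 0 := by rw [h3, hU, h₂]; simp

/-- Once the undressing relations are solved for `A_kᴴ G_k`, the factors along `P₁` and `P₂` cancel
against those around `U`. Only the lines `R_k` remain, and moving the `K_k` outside conjugates them.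
-/
theorem conj_mul_dress_mul_eq {c : ℂ} {P₁ P₂ R₁ R₂ A₁ A₂ K₁ K₂ G₁ G₂ F₁ F₂ U : Mat2} (hc : c ≠ 0)
    (hP₁ : IsLineProj P₁) (hP₂ : IsLineProj P₂) (hR₁ : IsLineProj R₁) (hR₂ : IsLineProj R₂)
    (hA₁ : A₁ ∈ Matrix.specialUnitaryGroup (Fin 2) ℂ)
    (hA₂ : A₂ ∈ Matrix.specialUnitaryGroup (Fin 2) ℂ)
    (hK₁ : K₁ ∈ Matrix.specialUnitaryGroup (Fin 2) ℂ)
    (hK₂ : K₂ ∈ Matrix.specialUnitaryGroup (Fin 2) ℂ) (hdF₁ : F₁.det = 1)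
    (hF₁ : F₁ = dress c (1 - P₁) R₁ (A₁ᴴ * G₁) * K₁)
    (hF₂ : F₂ = dress c (1 - P₂) R₂ (A₂ᴴ * G₂) * K₂) :
    G₁⁻¹ * (A₁ * dress c P₁ P₂ U * A₂ᴴ) * G₂ =
      K₁ * dress c⁻¹ (K₁ᴴ * R₁ * K₁) (K₂ᴴ * R₂ * K₂) (F₁⁻¹ * U * F₂) * K₂ᴴ := by
  have key : ∀ {A P R K G F : Mat2}, IsLineProj P → IsLineProj R →
      K ∈ Matrix.specialUnitaryGroup (Fin 2) ℂ →
      F = dress c (1 - P) R (Aᴴ * G) * K → Aᴴ * G = dress c⁻¹ (1 - P) R (F * Kᴴ) := by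
    intro A P R K G F hP hR hK hF
    rw [hF, mul_assoc, mul_conjTranspose_of_mem hK, mul_one, dress_inv_dress hc hP.compl hR]
  have h1 := key hP₁ hR₁ hK₁ hF₁
  have h2 := key hP₂ hR₂ hK₂ hF₂
  have hd : (F₁ * K₁ᴴ).det = 1 := by
    rw [Matrix.det_mul, hdF₁, det_of_mem (conjTranspose_mem hK₁), one_mul]
  have h1' : G₁⁻¹ * A₁ = dress c⁻¹ R₁ (1 - P₁) (K₁ * F₁⁻¹) := by
    have h3 := congrArg (·⁻¹) h1
    rwa [dress_inv (inv_ne_zero hc) hP₁.compl hR₁ hd, Matrix.mul_inv_rev, Matrix.mul_inv_rev,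
      inv_of_mem (conjTranspose_mem hA₁), inv_of_mem (conjTranspose_mem hK₁),
      Matrix.conjTranspose_conjTranspose, Matrix.conjTranspose_conjTranspose] at h3
  have hU : dress c P₁ P₂ U = dress c⁻¹ (1 - P₁) (1 - P₂) U := by rw [dress_compl, inv_inv]
  calc _ = G₁⁻¹ * A₁ * dress c P₁ P₂ U * (A₂ᴴ * G₂) := by simp only [mul_assoc]
    _ = dress c⁻¹ R₁ R₂ (K₁ * F₁⁻¹ * U * (F₂ * K₂ᴴ)) := by
        rw [h1', h2, hU, dress_mul_dress (inv_ne_zero hc) hP₁.compl,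
          dress_mul_dress (inv_ne_zero hc) hP₂.compl]
    _ = dress c⁻¹ R₁ R₂ (K₁ * (F₁⁻¹ * U * F₂) * K₂ᴴ) := by simp only [mul_assoc]
    _ = _ := dress_unitaryConj (inv_ne_zero hc) hK₁ hK₂

/-- The counterpart for positive factors. No simple factor is attached to `V`, so the same `V`
serves before and after dressing. -/
theorem mul_inv_mul_inv_eq {s : ℂ} {R₁ R₂ K₁ K₂ B₁ B₂ C₁ C₂ V : Mat2} (hs : s ≠ 0)
    (hR₁ : IsLineProj R₁) (hR₂ : IsLineProj R₂)
    (hK₁ : K₁ ∈ Matrix.specialUnitaryGroup (Fin 2) ℂ)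
    (hK₂ : K₂ ∈ Matrix.specialUnitaryGroup (Fin 2) ℂ)
    (hB₁ : B₁ = K₁ᴴ * simpleFactor s R₁ * C₁) (hB₂ : B₂ = K₂ᴴ * simpleFactor s R₂ * C₂) :
    C₂ * V * C₁⁻¹ =
      K₂ * dress (s ^ 2)⁻¹ (K₂ᴴ * R₂ * K₂) (K₁ᴴ * R₁ * K₁) (B₂ * V * B₁⁻¹) * K₁ᴴ := by
  rw [← dress_unitaryConj (inv_ne_zero (pow_ne_zero 2 hs)) hK₂ hK₁, ← inv_pow,
    dress_sq (inv_ne_zero hs), inv_inv, hB₁, hB₂, Matrix.mul_inv_rev, Matrix.mul_inv_rev,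
    inv_of_mem (conjTranspose_mem hK₁), Matrix.conjTranspose_conjTranspose, simpleFactor_inv hs hR₁]
  symm
  calc _ = simpleFactor s⁻¹ R₂ * ((K₂ * K₂ᴴ) * simpleFactor s R₂) * C₂ * V * C₁⁻¹ *
        (simpleFactor s⁻¹ R₁ * ((K₁ * K₁ᴴ) * simpleFactor s R₁)) := by simp only [mul_assoc]
    _ = _ := by
        rw [mul_conjTranspose_of_mem hK₁, mul_conjTranspose_of_mem hK₂, one_mul, one_mul,
          simpleFactor_inv_mul hs hR₁, simpleFactor_inv_mul hs hR₂, one_mul, mul_one]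

end Bridge

end

/-! ### The bridge theorem. -/

theorem mainTheorem8 {r : ℝ} (hr₀ : 0 < r) (hr₁ : r < 1)
    -- a punctured neighbourhood `Ω \ {0}` of `0` and its universal cover `E`
    {Ω : Set ℂ} (hΩ : IsOpen Ω) (h₀ : (0 : ℂ) ∈ Ω) (hconn : IsConnected (Ω \ {0}))
    {E : Type*} [TopologicalSpace E] [SimplyConnectedSpace E]
    (proj : E → ↥(Ω \ {0})) (hproj : IsCoveringMap proj)
    (Φ₁ Φ₂ : E → ℂ → Bridge.Mat2)
    (hΦ₁ : ∀ p, Bridge.IsLoop r (Φ₁ p)) (hΦ₂ : ∀ p, Bridge.IsLoop r (Φ₂ p))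
    (U V : ℂ → Bridge.Mat2)
    (hU : Bridge.IsMeroUnitaryLoop r U) (hV : Bridge.IsPositiveLoop r V)
    (hconv : Bridge.IwasawaConverge r (fun p => (proj p : ℂ)) Φ₁ Φ₂ U V (Bridge.sing r U))
    (l₀ : ℂ) (hl₀ : r < ‖l₀‖ ∧ ‖l₀‖ < 1) (hl₀U : l₀ ∉ Bridge.sing r U)
    (W : Bridge.Mat2) (L₁ L₂ : Bridge.CP1) (g₁ g₂ : ℂ → Bridge.Mat2)
    (hg₁ : Bridge.IsGeneralSimpleFactor r W l₀ L₁ g₁)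
    (hg₂ : Bridge.IsGeneralSimpleFactor r W l₀ L₂ g₂)
    (hL : L₂.submodule = L₁.submodule.map (Matrix.toEuclideanLin (U l₀)ᴴ)) :
    -- `Y` is the meromorphic extension to the annulus of the loop `g₁ U g₂⁻¹`
    ∃ Y : ℂ → Bridge.Mat2, Bridge.IsMeroUnitaryLoop r Y ∧
      (∀ l ∈ Metric.sphere (0 : ℂ) r, Y l = g₁ l * U l * (g₂ l)⁻¹) ∧
      Bridge.IwasawaConverge r (fun p => (proj p : ℂ))
        (fun p l => g₁ l * Φ₁ p l) (fun p l => g₂ l * Φ₂ p l) Y V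
        (Bridge.sing r U ∪ {l₀, Bridge.reflect l₀}) := by
  open Bridge in
  have h00 : l₀ ≠ 0 := norm_pos_iff.1 (hr₀.trans hl₀.1)
  have hl₀a : l₀ ∈ annulus r := ⟨hl₀.1, hl₀.2.trans ((one_lt_div hr₀).2 hr₁)⟩
  obtain ⟨s, hs, hsq, A₁, hA₁, A₂, hA₂, hg₁', hg₂'⟩ := exists_common_branch hr₀ hl₀ hg₁ hg₂
  have hs0 : ∀ l ∈ closedBall (0 : ℂ) r, s l ≠ 0 := fun l hl h =>
    ratMap_ne_zero_of_mem_closedBall hr₀ hl₀ hl (by rw [← hsq l hl, h]; ring)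
  have hP₁ := isLineProj_projMatrix L₁
  have hP₂ := isLineProj_projMatrix L₂
  have hPU := projMatrix_mul_eq_zero hL
  set P₁ := projMatrix L₁.submodule
  set P₂ := projMatrix L₂.submodule
  obtain ⟨Y, hY, hYs, hYa⟩ := hU.exists_dress hr₀ hl₀ hA₁ (conjTranspose_mem hA₂) hP₁ hP₂
  refine ⟨Y, hY, fun l hl => ?_, ?_⟩
  · have hlc := sphere_subset_closedBall hl
    rw [hYs l hl, hg₁' l hlc, hg₂' l hlc, ← hsq l hlc, dress_sq (hs0 l hlc), Matrix.mul_inv_rev,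
      inv_of_mem hA₂, simpleFactor_inv (hs0 l hlc) hP₂]
    simp only [mul_assoc]
  intro G₁ C₁ G₂ C₂ hI₁ hI₂
  choose F₁ B₁ R₁ K₁ hF₁ hR₁ hK₁ hT₁ hFa₁ hBb₁ hF0₁ using fun p =>
    (hI₁ p).exists_undress hr₀ hr₁ hl₀ hA₁ hP₁ hs hsq hg₁'
  choose F₂ B₂ R₂ K₂ hF₂ hR₂ hK₂ hT₂ hFa₂ hBb₂ hF0₂ using fun p =>
    (hI₂ p).exists_undress hr₀ hr₁ hl₀ hA₂ hP₂ hs hsq hg₂'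
  obtain ⟨hcF, hcB⟩ := hconv F₁ B₁ F₂ B₂ hF₁ hF₂
  have hTp₁ : ∀ p, IsLineProj ((K₁ p)ᴴ * R₁ p * K₁ p) := fun p => (hR₁ p).unitaryConj (hK₁ p)
  have hTp₂ : ∀ p, IsLineProj ((K₂ p)ᴴ * R₂ p * K₂ p) := fun p => (hR₂ p).unitaryConj (hK₂ p)
  -- The projection `K_kᴴ R_k K_k` has range orthogonal to the dressed line `F_k(l₀)ᴴ L_k`. This is
  -- where the relation between `L₁` and `L₂` enters.
  have hsub : Tendsto (fun p => (K₁ p)ᴴ * R₁ p * K₁ p - (K₂ p)ᴴ * R₂ p * K₂ p)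
      (comap (fun p => (proj p : ℂ)) (𝓝 0)) (𝓝 0) := by
    obtain ⟨R, hR, hmem⟩ := exists_region_of_notMem_sing hU.mero hl₀a hl₀U
    refine tendsto_sub_of_mul_eq_zero hTp₁ hTp₂ ((hcF R hR).tendsto_at hmem) fun p => ?_
    refine compl_mul_mul_eq_zero hP₁ (hTp₁ p) ((hF₁ p).unitary.det_eq l₀ hl₀a) ?_ ?_ hPU
    · rw [← mul_assoc, hF0₁ p, zero_mul]
    · rw [← mul_assoc, hF0₂ p, zero_mul]
  have hsub' : Tendsto (fun p => (K₂ p)ᴴ * R₂ p * K₂ p - (K₁ p)ᴴ * R₁ p * K₁ p)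
      (comap (fun p => (proj p : ℂ)) (𝓝 0)) (𝓝 0) := by
    simpa only [neg_sub, neg_zero] using hsub.neg
  have hs00 : s 0 ≠ 0 := hs0 0 (by simpa using hr₀.le)
  have hpos₁ : ∀ p, PosTriangular (simpleFactor (s 0) ((K₁ p)ᴴ * R₁ p * K₁ p) * (K₁ p)ᴴ) :=
    fun p => by rw [← simpleFactor_conj (hK₁ p)]; exact hT₁ p
  have hpos₂ : ∀ p, PosTriangular (simpleFactor (s 0) ((K₂ p)ᴴ * R₂ p * K₂ p) * (K₂ p)ᴴ) :=
    fun p => by rw [← simpleFactor_conj (hK₂ p)]; exact hT₂ p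
  have hKK := tendsto_mul_conjTranspose hs00 hTp₁ hTp₂ hK₁ hK₂ hsub hpos₁ hpos₂
  -- The positive quotient has its indices in the opposite order, so both versions are needed.
  have hKK' := tendsto_mul_conjTranspose hs00 hTp₂ hTp₁ hK₂ hK₁ hsub' hpos₂ hpos₁
  constructor
  · intro R hR
    obtain ⟨δ, hδ, haway⟩ := hR.away
    have hR' : IsRegionAwayFrom r (sing r U) R :=
      ⟨hR.isOpen, hR.connected, hR.subset, δ, hδ, fun l hl t ht => haway l hl t (Or.inl ht)⟩
    obtain ⟨C, hC⟩ := exists_ratMap_bound h00 hl₀.2 hδ (1 / r)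
    have hb : ∀ l ∈ R, (ratMap l₀ l)⁻¹ ≠ 0 ∧ ‖(ratMap l₀ l)⁻¹‖ ≤ C ∧
        ‖((ratMap l₀ l)⁻¹)⁻¹‖ ≤ C := fun l hl => by
      obtain ⟨h1, h2, h3⟩ := hC l (hR.subset hl).2.le (haway l hl _ (by simp))
        (haway l hl _ (by simp))
      exact ⟨inv_ne_zero h1, h3, by rwa [inv_inv]⟩
    refine (tendstoUniformlyOn_dress hb hTp₁ hTp₂ hK₁ hK₂ hsub hKK (hcF R hR')).congr
      (Eventually.of_forall fun p l hl => ?_)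
    have hne : ∀ t ∈ sing r U ∪ {l₀, reflect l₀}, l ≠ t := by
      rintro t ht rfl
      have := haway l hl l ht
      rw [dist_self] at this
      linarith
    have hla := hR.subset hl
    have h1 : l ≠ l₀ := hne _ (by simp)
    have h2 : l ≠ reflect l₀ := hne _ (by simp)
    simp only
    rw [hYa l hla (fun h => hne l (Or.inl h) rfl) h1 h2]
    exact (conj_mul_dress_mul_eq (ratMap_ne_zero h00 hl₀.2 h1 h2) hP₁ hP₂ (hR₁ p) (hR₂ p) hA₁ hA₂
      (hK₁ p) (hK₂ p) ((hF₁ p).unitary.det_eq l hla) (hFa₁ p l hla h1 h2)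
      (hFa₂ p l hla h1 h2)).symm
  -- Both `l₀` and its mirror image lie at least this far from the disc, so `f` and `f⁻¹` are
  -- bounded on all of it.
  · have hδ : 0 < ‖l₀‖ - r := sub_pos.2 hl₀.1
    obtain ⟨C, hC⟩ := exists_ratMap_bound h00 hl₀.2 hδ r
    have hb : ∀ l ∈ ball (0 : ℂ) r, (ratMap l₀ l)⁻¹ ≠ 0 ∧ ‖(ratMap l₀ l)⁻¹‖ ≤ C ∧
        ‖((ratMap l₀ l)⁻¹)⁻¹‖ ≤ C := fun l hl => by
      have hl' : ‖l‖ < r := by simpa using hl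
      have hdist : ∀ t : ℂ, ‖l₀‖ ≤ ‖t‖ → ‖l₀‖ - r ≤ dist l t := fun t ht => by
        have := norm_sub_norm_le t l
        rw [dist_comm, dist_eq_norm]
        linarith
      have hrefl : ‖l₀‖ ≤ ‖reflect l₀‖ := by
        have : 1 < ‖l₀‖⁻¹ := (one_lt_inv₀ (hr₀.trans hl₀.1)).2 hl₀.2
        rw [norm_reflect]
        linarith [hl₀.2]
      obtain ⟨h1, h2, h3⟩ := hC l hl'.le (hdist _ le_rfl) (hdist _ hrefl)
      exact ⟨inv_ne_zero h1, h3, by rwa [inv_inv]⟩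
    refine (tendstoUniformlyOn_dress hb hTp₂ hTp₁ hK₂ hK₁ hsub' hKK' hcB).congr
      (Eventually.of_forall fun p l hl => ?_)
    have hlc := ball_subset_closedBall hl
    simp only
    rw [← hsq l hlc]
    exact (mul_inv_mul_inv_eq (hs0 l hlc) (hR₁ p) (hR₂ p) (hK₁ p) (hK₂ p) (hBb₁ p l hl)
      (hBb₂ p l hl)).symm
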